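/- Let $\mathbb{T}^3=(\mathbb{R}/2\pi\mathbb{Z})^3$ and let $U\in W^{1,\infty}(\mathbb{T}^3;\mathbb{R}^3)$, i.e. $U$ is a Lipschitz, $2\pi$-periodic vector field. Assume that $U$ is \emph{alpha-unstable}, which means the following. First, $U$ is mean-free, $\nabla\cdot U=0$, and $\|\nabla U\|_{L^\infty}<1$ (Euclidean operator norm); then for every $v\in\mathbb{C}^3$ the problem $$\nabla\times(U\times S)+\Delta S=\nabla\times(v\times U),\qquad \int_{\mathbb{T}^3}S\,dx=0,$$ has a unique distributional solution $S=\mathcal{S}(v)\in L^2(\mathbb{T}^3;\mathbb{C}^3)$. Second, there are a nonzero $\boldsymbol{j}\in\mathbb{R}^3$ and an algebraically simple eigenvalue $\mu\in\mathbb{C}$ with $\operatorname{Re}\mu>0$ of the matrix $A=A(U,\boldsymbol{j})\in\mathbb{C}^{3\times3}$ defined by $$Av=i\,\frac{\boldsymbol{j}}{|\boldsymbol{j}|}\times\frac1{|\mathbb{T}^3|}\int_{\mathbb{T}^3}U\times\mathcal{S}(v)\,dx,\qquad v\in\mathbb{C}^3.$$ Then there exist $\boldsymbol{j}_\star\in\mathbb{R}^3$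 with $|\boldsymbol{j}_\star|\le 1$, $p_\star\in\mathbb{C}$ with $\operatorname{Re}p_\star>0$, and a nonzero $H\in L^2(\mathbb{T}^3;\mathbb{C}^3)$ such that, in the sense of distributions on $\mathbb{T}^3$, $$(\nabla+i\boldsymbol{j}_\star)\times(U\times H)+(\nabla+i\boldsymbol{j}_\star)^2H=p_\star H,\qquad (\nabla+i\boldsymbol{j}_\star)\cdot H=0.$$ -/

import Mathlib

open MeasureTheory

namespace AlphaEffect

/-- Three-dimensional Euclidean space `ℝ³`. -/
abbrev E3 : Type := EuclideanSpace ℝ (Fin 3)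

/-- The vector space `ℂ³` (its norm plays no role below, up to equivalence). -/
abbrev C3 : Type := Fin 3 → ℂ

/-- Functions on the torus `𝕋³ = (ℝ / 2πℤ)³` are the functions on `ℝ³` that are `2π`-periodic in
each coordinate. -/
def IsPeriodic {β : Type*} (f : E3 → β) : Prop :=
  ∀ (i : Fin 3) (x : E3), f (x + EuclideanSpace.single i (2 * Real.pi)) = f x

/-- The fundamental cell `[0, 2π)³`; integrals over `𝕋³` are integrals over it. -/
def cell : Set E3 := {x | ∀ i : Fin 3, x i ∈ Set.Ico (0 : ℝ) (2 * Real.pi)}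

/-- `F ∈ L²(𝕋³; ℂ³)`. -/
def MemL2 (F : E3 → C3) : Prop :=
  IsPeriodic F ∧ MemLp F 2 (volume.restrict cell)

/-- Test functions on the torus: smooth, periodic, complex-valued. -/
structure TorusTest where
  toFun : E3 → ℂ
  smooth : ContDiff ℝ ((⊤ : ℕ∞) : WithTop ℕ∞) toFun
  periodic : IsPeriodic toFun

/-- The partial derivative `∂ₐ φ` of a test function. -/
noncomputable def TorusTest.pderiv (a : Fin 3) (φ : TorusTest) : TorusTest where
  toFun x := fderiv ℝ φ.toFun x (EuclideanSpace.single a 1)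
  smooth := (φ.smooth.fderiv_right (by simp)).clm_apply contDiff_const
  periodic := by
    intro i x
    have h : (fun y : E3 => φ.toFun (y + EuclideanSpace.single i (2 * Real.pi))) = φ.toFun :=
      funext fun y => φ.periodic i y
    have h2 := fderiv_comp_add_right (𝕜 := ℝ) (f := φ.toFun) (x := x)
      (EuclideanSpace.single i (2 * Real.pi))
    rw [h] at h2
    simp only [← h2]

/-- Functionals on test functions. The ones used are the integrable functions on the torus and
their distributional derivatives, so equality of two of them is equality of distributions. -/
abbrev TorusDist : Type := TorusTest → ℂ

/-- The distribution `φ ↦ ∫_{𝕋³} f φ` defined by a function `f` on the torus. -/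
noncomputable def distOf (f : E3 → ℂ) : TorusDist :=
  fun φ => ∫ x in cell, f x * φ.toFun x

/-- The vector-valued distribution defined by a vector field on the torus. -/
noncomputable def distOfField (F : E3 → C3) : Fin 3 → TorusDist :=
  fun i => distOf (fun x => F x i)

/-- The operator `∂ₐ + i jₐ` on distributions, where `(∂ₐ T)(φ) = - T(∂ₐ φ)`. -/
noncomputable def modalD (j : E3) (a : Fin 3) (T : TorusDist) : TorusDist :=
  fun φ => -T (φ.pderiv a) + Complex.I * (j a : ℂ) * T φ

/-- `(∇ + i j) × T`. For `j = 0` it is the curl. -/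
noncomputable def modalCurl (j : E3) (T : Fin 3 → TorusDist) : Fin 3 → TorusDist :=
  ![modalD j 1 (T 2) - modalD j 2 (T 1),
    modalD j 2 (T 0) - modalD j 0 (T 2),
    modalD j 0 (T 1) - modalD j 1 (T 0)]

/-- `(∇ + i j) · T`. For `j = 0` it is the divergence. -/
noncomputable def modalDiv (j : E3) (T : Fin 3 → TorusDist) : TorusDist :=
  ∑ a : Fin 3, modalD j a (T a)

/-- `(∇ + i j)² T`, componentwise. For `j = 0` it is the Laplacian. -/
noncomputable def modalLaplacian (j : E3) (T : Fin 3 → TorusDist) : Fin 3 → TorusDist :=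
  fun i => ∑ a : Fin 3, modalD j a (modalD j a (T i))

/-- A real vector seen as a complex one. -/
def toC3 (w : E3) : C3 := fun i => (w i : ℂ)

/-- The field `x ↦ U(x) × H(x)`. -/
def crossField (U : E3 → E3) (H : E3 → C3) : E3 → C3 :=
  fun x => crossProduct (toC3 (U x)) (H x)

/-- `S ∈ L²(𝕋³)` is a solution, in the sense of distributions, of
`∇ × (U × S) + Δ S = ∇ × (v × U)` with `∫_{𝕋³} S = 0`. -/
def IsCellSolution (U : E3 → E3) (v : C3) (S : E3 → C3) : Prop :=
  MemL2 S ∧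
  modalCurl 0 (distOfField (crossField U S)) + modalLaplacian 0 (distOfField S)
    = modalCurl 0 (distOfField (fun x => crossProduct v (toC3 (U x)))) ∧
  ∫ x in cell, S x = 0

/-- The solution map `v ↦ 𝒮(v)`: a solution of the elliptic problem (it exists, and is unique
almost everywhere, for the fields `U` considered in `AlphaUnstable`). -/
noncomputable def solutionMap (U : E3 → E3) (v : C3) : E3 → C3 :=
  Classical.epsilon (IsCellSolution U v)

/-- The map `v ↦ i (j / |j|) × ⨍_{𝕋³} U × 𝒮(v)`. -/
noncomputable def alphaMap (U : E3 → E3) (j : E3) (v : C3) : C3 :=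
  Complex.I • crossProduct (toC3 (‖j‖⁻¹ • j)) (⨍ x in cell, crossField U (solutionMap U v) x)

/-- The matrix `A(U, j)` of the linear map `alphaMap U j` in the standard basis of `ℂ³`. -/
noncomputable def alphaMatrix (U : E3 → E3) (j : E3) : Matrix (Fin 3) (Fin 3) ℂ :=
  Matrix.of fun i k => alphaMap U j (Pi.single k 1) i

/-- `U ∈ W^{1,∞}(𝕋³; ℝ³)`: a Lipschitz continuous vector field on the torus. -/
def IsW1Infty (U : E3 → E3) : Prop :=
  IsPeriodic U ∧ ∃ K : NNReal, LipschitzWith K U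

/-- Alpha-instability of a field `U ∈ W^{1,∞}(𝕋³; ℝ³)`. A Lipschitz field is differentiable almost
everywhere, and `fderiv ℝ U x` is its gradient, measured in the Euclidean operator norm. A simple
eigenvalue is one of algebraic multiplicity one. -/
structure AlphaUnstable (U : E3 → E3) : Prop where
  mean_free : ∫ x in cell, U x = 0
  incompressible : modalDiv 0 (distOfField fun x => toC3 (U x)) = 0
  grad_lt_one : eLpNorm (fderiv ℝ U) ⊤ volume < 1
  exists_unstable : ∃ j : E3, j ≠ 0 ∧ ∃ μ : ℂ,
    (alphaMatrix U j).charpoly.rootMultiplicity μ = 1 ∧ 0 < μ.re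

end AlphaEffect

open MeasureTheory

namespace AlphaEffect

/-! ### Order-zero Fourier multipliers and invertibility of the cell operator -/

section

open scoped InnerProductSpace

/-! The unstable mode is sought at the wave vector εj, with |j| = 1 and ε > 0 small, in the form H =
v + S with v constant and S mean-free, and with growth rate p = ελ. Pass to Fourier coefficients and
let B be the operator U×. The zero mode of the eigenvalue equation, divided by ε, reads i j × (B(v +
S))₀ = (λ + ε)v. The other modes, divided by |k|², form a linear equation for S given v whose
operators are polynomial in (ε, λ) (`modalOp`, `modalSource`). At ε = 0 it is the cell problem, and
the zero mode becomes Av = λv because U × v is mean-free.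

If the cell operator is invertible, S can be eliminated near ε = 0. There remains one scalar
equation F(ε, λ) = det(λ + ε - M(ε, λ)) = 0 with F of class C¹ and F(0, ·) the characteristic
polynomial of A. Simplicity of μ means ∂F/∂λ ≠ 0 at (0, μ), so a zero λ near μ persists for small ε
(`eventually_exists_zero`), and Re p = ε Re λ > 0. The divergence condition is then automatic: take
the dot product of each mode of the equation with k + εj.

Invertibility uses the smallness of ∇U. With N = (-Δ)^(-1/2) and P = ∇ × N, the cell operator is 1 -
NPB. As P is self-adjoint and P³ = P, exchanging factors reduces the claim to coercivity of 1 -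
P²BNP, that is to Re⟨U × s, ∇ × s⟩ ≤ c‖s‖² with c < 1 for the divergence-free fields s = NPx
(`re_inner_coefOp_le`). This comes from (U × s) · (∇ × s) = U · ∇(|s|²/2) - U · (s · ∇)s: the first
term integrates to zero since ∇ · U = 0, and the second, integrated by parts, is the quadratic form
of ∇U at s.

The distributions in the statement are recovered from their Fourier coefficients (`HasCoeff`), so
equations between them are equations mode by mode. -/

/-- `ℂ³` with its Hermitian inner product. -/
abbrev X3 : Type := EuclideanSpace ℂ (Fin 3)

/-- Frequencies of Fourier series on the torus. -/
abbrev Freq : Type := Fin 3 → ℤ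

/-- Square-summable vector-valued Fourier coefficients. -/
abbrev Coef : Type := lp (fun _ : Freq => X3) 2

/-- The cross product as a continuous bilinear map. -/
noncomputable def crossX : C3 →L[ℂ] X3 →L[ℂ] X3 :=
  LinearMap.toContinuousLinearMap
    { toFun := fun w => LinearMap.toContinuousLinearMap
        ((WithLp.linearEquiv 2 ℂ C3).symm.toLinearMap ∘ₗ crossProduct w ∘ₗ
          (WithLp.linearEquiv 2 ℂ C3).toLinearMap)
      map_add' := fun a b => by ext; simp
      map_smul' := fun a b => by ext; simp }

theorem ofLp_crossX (w : C3) (x : X3) : (crossX w x).ofLp = crossProduct w x.ofLp := rfl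

theorem crossX_apply_zero (w : C3) (x : X3) : crossX w x 0 = w 1 * x 2 - w 2 * x 1 := by
  rw [ofLp_crossX, cross_apply]; rfl

theorem crossX_apply_one (w : C3) (x : X3) : crossX w x 1 = w 2 * x 0 - w 0 * x 2 := by
  rw [ofLp_crossX, cross_apply]; rfl

theorem crossX_apply_two (w : C3) (x : X3) : crossX w x 2 = w 0 * x 1 - w 1 * x 0 := by
  rw [ofLp_crossX, cross_apply]; rfl

section Multiplier

/-- The Fourier multiplier with a bounded matrix-valued symbol. -/
noncomputable def mult (m : Freq → X3 →L[ℂ] X3) (C : ℝ) (hC : ∀ k, ‖m k‖ ≤ C) :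
    Coef →L[ℂ] Coef :=
  have hC0 : 0 ≤ C := (norm_nonneg _).trans (hC 0)
  have hb : ∀ (f : Coef) k, ‖m k (f k)‖ ≤ ‖((C : ℂ) • f) k‖ := fun f k => by
    have : ‖((C : ℂ) • f) k‖ = C * ‖f k‖ := by
      rw [lp.coeFn_smul, Pi.smul_apply, norm_smul, Complex.norm_real, Real.norm_of_nonneg hC0]
    rw [this]
    exact (m k).le_of_opNorm_le (hC k) _
  LinearMap.mkContinuous
    { toFun := fun f => ⟨fun k => m k (f k), (lp.memℓp ((C : ℂ) • f)).mono' (hb f)⟩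
      map_add' := fun f g => by ext1; funext k; exact map_add (m k) _ _
      map_smul' := fun a f => by ext1; funext k; exact map_smul (m k) _ _ }
    C fun f => by
      have h := lp.norm_mono (p := 2) (by norm_num)
        (x := (⟨fun k => m k (f k), (lp.memℓp ((C : ℂ) • f)).mono' (hb f)⟩ : Coef))
        (y := (C : ℂ) • f) (hb f)
      refine h.trans ?_
      rw [norm_smul, Complex.norm_real, Real.norm_of_nonneg hC0]

variable {m : Freq → X3 →L[ℂ] X3} {C : ℝ} {hC : ∀ k, ‖m k‖ ≤ C}

@[simp] theorem mult_apply (f : Coef) (k : Freq) : mult m C hC f k = m k (f k) := rfl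

theorem norm_mult_le (f : Coef) : ‖mult m C hC f‖ ≤ C * ‖f‖ :=
  (mult m C hC).le_of_opNorm_le
    (by unfold mult; exact LinearMap.mkContinuous_norm_le _ ((norm_nonneg _).trans (hC 0)) _) f

theorem inner_mult_left (h : ∀ k x y, ⟪m k x, y⟫_ℂ = ⟪x, m k y⟫_ℂ) (f g : Coef) :
    ⟪mult m C hC f, g⟫_ℂ = ⟪f, mult m C hC g⟫_ℂ := by
  simp only [lp.inner_eq_tsum, mult_apply, h]

end Multiplier

/-- A frequency as a vector of `ℝ³`. -/
noncomputable def freqVec (k : Freq) : E3 := WithLp.toLp 2 fun a => (k a : ℝ)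

@[simp] theorem freqVec_apply (k : Freq) (a : Fin 3) : freqVec k a = (k a : ℝ) := rfl

@[simp] theorem freqVec_zero : freqVec 0 = 0 := by ext; simp

theorem norm_freqVec_sq (k : Freq) :
    ‖freqVec k‖ ^ 2 = (k 0 : ℝ) ^ 2 + (k 1 : ℝ) ^ 2 + (k 2 : ℝ) ^ 2 := by
  rw [EuclideanSpace.norm_sq_eq, Fin.sum_univ_three]; simp

theorem one_le_norm_freqVec {k : Freq} (hk : k ≠ 0) : 1 ≤ ‖freqVec k‖ := by
  rw [← one_le_sq_iff₀ (norm_nonneg _), norm_freqVec_sq]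
  have : (1 : ℤ) ≤ k 0 ^ 2 + k 1 ^ 2 + k 2 ^ 2 := by
    by_contra! h
    refine hk (funext fun a => ?_)
    have h0 : k 0 = 0 := by nlinarith [sq_nonneg (k 0), sq_nonneg (k 1), sq_nonneg (k 2)]
    have h1 : k 1 = 0 := by nlinarith [sq_nonneg (k 0), sq_nonneg (k 1), sq_nonneg (k 2)]
    have h2 : k 2 = 0 := by nlinarith [sq_nonneg (k 0), sq_nonneg (k 1), sq_nonneg (k 2)]
    fin_cases a <;> assumption
  exact_mod_cast this

theorem norm_inv_freqVec_le (k : Freq) : ‖((‖freqVec k‖⁻¹ : ℝ) : ℂ)‖ ≤ 1 := by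
  rw [Complex.norm_real, norm_inv, norm_norm]
  rcases eq_or_ne k 0 with rfl | hk
  · simp
  · exact inv_le_one_of_one_le₀ (one_le_norm_freqVec hk)

/-- The symbol `1 / |k|` of `(-Δ)^{-1/2}` on mean-free fields. -/
noncomputable def symbN (k : Freq) : X3 →L[ℂ] X3 :=
  ((‖freqVec k‖⁻¹ : ℝ) : ℂ) • ContinuousLinearMap.id ℂ X3

theorem norm_symbN_le (k : Freq) : ‖symbN k‖ ≤ 1 := by
  rw [symbN, norm_smul]
  exact mul_le_one₀ (norm_inv_freqVec_le k) (norm_nonneg _) ContinuousLinearMap.norm_id_le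

/-- The symbol `i k × / |k|` of the order-zero curl. -/
noncomputable def symbP (k : Freq) : X3 →L[ℂ] X3 :=
  (((‖freqVec k‖⁻¹ : ℝ) : ℂ) * Complex.I) • crossX (toC3 (freqVec k))

theorem inner_symbP_left (k : Freq) (x y : X3) : ⟪symbP k x, y⟫_ℂ = ⟪x, symbP k y⟫_ℂ := by
  simp only [symbP, PiLp.inner_apply, Fin.sum_univ_three, smul_apply,
    PiLp.smul_apply, crossX_apply_zero, crossX_apply_one, crossX_apply_two, RCLike.inner_apply,
    smul_eq_mul, map_mul, map_sub, Complex.conj_I, Complex.conj_ofReal, toC3, freqVec_apply]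
  ring

/-- The identity k × (k × (k × y)) = -|k|² k × y. For k ≠ 0 the symbol therefore acts as 0 along k
and squares to the identity on the plane orthogonal to k. -/
theorem symbP_symbP_symbP (k : Freq) (x : X3) : symbP k (symbP k (symbP k x)) = symbP k x := by
  rcases eq_or_ne k 0 with rfl | hk
  -- The convention 0⁻¹ = 0 makes the symbol vanish at frequency 0.
  · simp [symbP]
  have hne : ((‖freqVec k‖ : ℝ) : ℂ) ≠ 0 := by
    have := one_le_norm_freqVec hk
    exact_mod_cast (by linarith : (0 : ℝ) < ‖freqVec k‖).ne'
  have hsq : ((‖freqVec k‖ : ℝ) : ℂ) ^ 2 = (k 0 : ℂ) ^ 2 + (k 1 : ℂ) ^ 2 + (k 2 : ℂ) ^ 2 := by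
    exact_mod_cast congrArg (fun t : ℝ => (t : ℂ)) (norm_freqVec_sq k)
  have hcube : ∀ y : X3, crossX (toC3 (freqVec k)) (crossX (toC3 (freqVec k))
      (crossX (toC3 (freqVec k)) y)) =
      -((‖freqVec k‖ : ℝ) : ℂ) ^ 2 • crossX (toC3 (freqVec k)) y := by
    intro y
    rw [hsq]
    ext i
    fin_cases i <;>
      simp [crossX_apply_zero, crossX_apply_one, crossX_apply_two, toC3] <;> ring
  simp only [symbP, smul_apply, map_smul, smul_smul, hcube]
  congr 1
  push_cast
  field_simp
  linear_combination (-1 : ℂ) * Complex.I_sq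

/-- Self-adjointness and P³ = P suffice: ‖Px‖² = ⟨P²x, x⟩ ≤ ‖P²x‖‖x‖ and ‖P²x‖² = ⟨Px, Px⟩. -/
theorem norm_symbP_apply_le (k : Freq) (x : X3) : ‖symbP k x‖ ≤ ‖x‖ := by
  have h1 : ‖symbP k x‖ ^ 2 ≤ ‖symbP k (symbP k x)‖ * ‖x‖ := by
    have : ((‖symbP k x‖ : ℂ)) ^ 2 = ⟪symbP k (symbP k x), x⟫_ℂ := by
      rw [inner_symbP_left, inner_self_eq_norm_sq_to_K]; rfl
    have h2 : ‖((‖symbP k x‖ : ℂ)) ^ 2‖ ≤ ‖symbP k (symbP k x)‖ * ‖x‖ :=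
      this ▸ norm_inner_le_norm _ _
    simpa using h2
  have h2 : ‖symbP k (symbP k x)‖ ^ 2 ≤ ‖symbP k x‖ * ‖symbP k x‖ := by
    have : ((‖symbP k (symbP k x)‖ : ℂ)) ^ 2 = ⟪symbP k x, symbP k x⟫_ℂ := by
      have h := inner_symbP_left k (symbP k (symbP k x)) (symbP k x)
      rw [symbP_symbP_symbP] at h
      rw [h, inner_self_eq_norm_sq_to_K]
      rfl
    have h3 : ‖((‖symbP k (symbP k x)‖ : ℂ)) ^ 2‖ ≤ ‖symbP k x‖ * ‖symbP k x‖ :=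
      this ▸ norm_inner_le_norm _ _
    simpa using h3
  have h3 : ‖symbP k (symbP k x)‖ ≤ ‖symbP k x‖ := by
    rw [← sq] at h2
    exact (sq_le_sq₀ (norm_nonneg _) (norm_nonneg _)).1 h2
  rcases (norm_nonneg (symbP k x)).eq_or_lt with h | h
  · rw [← h]; exact norm_nonneg _
  · refine le_of_mul_le_mul_left ?_ h
    calc _ = ‖symbP k x‖ ^ 2 := (sq _).symm
      _ ≤ _ := h1.trans (by gcongr)

theorem norm_symbP_le (k : Freq) : ‖symbP k‖ ≤ 1 :=
  ContinuousLinearMap.opNorm_le_bound _ zero_le_one fun x => by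
    simpa using norm_symbP_apply_le k x

/-- The multiplier `(-Δ)^{-1/2}`, vanishing on constants. -/
noncomputable def opN : Coef →L[ℂ] Coef := mult symbN 1 norm_symbN_le

/-- The multiplier `∇ × (-Δ)^{-1/2}`. -/
noncomputable def opP : Coef →L[ℂ] Coef := mult symbP 1 norm_symbP_le

theorem opP_opP_opP (f : Coef) : opP (opP (opP f)) = opP f := by
  ext1; funext k; exact symbP_symbP_symbP k _

theorem inner_opP_left (f g : Coef) : ⟪opP f, g⟫_ℂ = ⟪f, opP g⟫_ℂ :=
  inner_mult_left inner_symbP_left f g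

theorem norm_opP_le (f : Coef) : ‖opP f‖ ≤ ‖f‖ := by
  simpa [opP] using norm_mult_le (hC := norm_symbP_le) f

theorem norm_opN_le (f : Coef) : ‖opN f‖ ≤ ‖f‖ := by
  simpa [opN] using norm_mult_le (hC := norm_symbN_le) f

/-- The spectra of ab and ba agree away from 0, here at the point 1. -/
theorem isUnit_one_sub_mul_swap {A : Type*} [Ring A] [Algebra ℂ A] {a b : A}
    (h : IsUnit (1 - a * b)) : IsUnit (1 - b * a) := by
  have := (spectrum.unit_mem_mul_comm (R := ℂ) (a := a) (b := b) (r := 1)).not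
  simpa [spectrum.mem_iff, h] using this

/-- The cell problem is uniquely solvable when the energy estimate holds. -/
theorem isUnit_one_sub_opN_opP (B : Coef →L[ℂ] Coef) {c : ℝ} (hc0 : 0 ≤ c) (hc : c < 1)
    (hB : ∀ x : Coef, (⟪B (opN (opP x)), opP (opP x)⟫_ℂ).re ≤ c * ‖opN (opP x)‖ ^ 2) :
    IsUnit (1 - opN * opP * B) := by
  -- This ordering of the factors is coercive with constant 1 - c: moving P² across the inner
  -- product produces exactly the pairing in `hB`, and ‖NPx‖ ≤ ‖x‖.
  have key : IsUnit (1 - (opP * opP * B * opN * opP)) := by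
    refine ContinuousLinearMap.isUnit_of_forall_le_norm_inner_map _
      (c := (1 - c).toNNReal) (Real.toNNReal_pos.2 (by linarith)) fun x => ?_
    refine le_trans ?_ (Complex.abs_re_le_norm _)
    refine le_trans ?_ (le_abs_self _)
    have h1 : (⟪(1 - opP * opP * B * opN * opP) x, x⟫_ℂ).re =
        ‖x‖ ^ 2 - (⟪B (opN (opP x)), opP (opP x)⟫_ℂ).re := by
      simp only [sub_apply, one_apply_eq_self, mul_apply_eq_comp, inner_sub_left, inner_opP_left, Complex.sub_re]
      congr 1
      exact inner_self_eq_norm_sq (𝕜 := ℂ) x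
    rw [h1]
    have h2 : ‖opN (opP x)‖ ^ 2 ≤ ‖x‖ ^ 2 := by
      gcongr
      exact (norm_opN_le _).trans (norm_opP_le x)
    have h3 := hB x
    rw [Real.coe_toNNReal _ (by linarith)]
    nlinarith [mul_le_mul_of_nonneg_left h2 hc0]
  -- Moving the last P to the front gives P³ = P; a second exchange then brings N to the front.
  have h2 : IsUnit (1 - opP * (B * opN)) := by
    have h3 := isUnit_one_sub_mul_swap (a := opP * opP * B * opN) (b := opP) key
    have : opP * (opP * opP * B * opN) = opP * (B * opN) := by
      ext1 x; exact opP_opP_opP _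
    rwa [this] at h3
  have h4 := isUnit_one_sub_mul_swap (a := opP * B) (b := opN) (by rwa [mul_assoc])
  rwa [← mul_assoc] at h4

end
-- Persistence of the simple eigenvalue for small ε
section

open scoped InnerProductSpace Topology

/-- A simple zero of `F (0, ·)` persists as a zero of `F (ε, ·)` for small real `ε > 0`. -/
theorem eventually_exists_zero {F : ℂ × ℂ → ℂ} {μ : ℂ} (hF : ContDiffAt ℂ 1 F (0, μ))
    (h0 : F (0, μ) = 0) (hd : deriv (fun l => F (0, l)) μ ≠ 0) {N : Set (ℂ × ℂ)}
    (hN : N ∈ 𝓝 ((0 : ℂ), μ)) :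
    ∀ᶠ ε : ℝ in 𝓝 0, ∃ l : ℂ, ((ε : ℂ), l) ∈ N ∧ F ((ε : ℂ), l) = 0 := by
  have hs := hF.hasStrictFDerivAt one_ne_zero
  set D := fderiv ℂ F (0, μ)
  have hD : D (0, 1) = deriv (fun l => F (0, l)) μ := by
    have h1 : HasDerivAt (fun l : ℂ => ((0 : ℂ), l)) (0, 1) μ :=
      (hasDerivAt_const μ (0 : ℂ)).prodMk (hasDerivAt_id μ)
    exact (hs.hasFDerivAt.comp_hasDerivAt μ h1).deriv.symm
  have hΦ : HasStrictFDerivAt (fun z : ℂ × ℂ => (z.1, F z))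
      ((ContinuousLinearMap.fst ℂ ℂ ℂ).prod D) (0, μ) := hasStrictFDerivAt_fst.prodMk hs
  -- The derivative of (ε, λ) ↦ (ε, F) is triangular with nonzero diagonal. The map is thus open at
  -- (0, μ), and the image of `N` contains (ε, 0) for all small ε.
  have hsurj : ((ContinuousLinearMap.fst ℂ ℂ ℂ).prod D).range = ⊤ := by
    rw [LinearMap.range_eq_top]
    rintro ⟨a, b⟩
    refine ⟨(a, (b - D (a, 0)) / D (0, 1)), ?_⟩
    have h1 : ((a, (b - D (a, 0)) / D (0, 1)) : ℂ × ℂ) =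
        (a, 0) + ((b - D (a, 0)) / D (0, 1)) • ((0 : ℂ), (1 : ℂ)) := by simp
    have h2 : D (a, (b - D (a, 0)) / D (0, 1)) = b := by
      rw [h1, map_add, map_smul, smul_eq_mul, div_mul_cancel₀ _ (hD ▸ hd)]
      ring
    exact Prod.ext rfl h2
  have hmap := hΦ.map_nhds_eq_of_surj hsurj
  have himg : (fun z : ℂ × ℂ => (z.1, F z)) '' N ∈ 𝓝 ((0 : ℂ), (0 : ℂ)) := by
    have := Filter.image_mem_map (m := fun z : ℂ × ℂ => (z.1, F z)) hN
    rwa [hmap, h0] at this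
  have hc : Filter.Tendsto (fun ε : ℝ => ((ε : ℂ), (0 : ℂ))) (𝓝 0) (𝓝 ((0 : ℂ), (0 : ℂ))) := by
    have : Continuous fun ε : ℝ => ((ε : ℂ), (0 : ℂ)) := by fun_prop
    simpa using this.tendsto 0
  filter_upwards [hc himg] with ε hε
  obtain ⟨⟨a, l⟩, hz, he⟩ := hε
  simp only [Prod.mk.injEq] at he
  obtain ⟨rfl, h2⟩ := he
  exact ⟨l, hz, h2⟩

theorem contDiffAt_det {M : ℂ × ℂ → Matrix (Fin 3) (Fin 3) ℂ} {z : ℂ × ℂ}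
    (h : ∀ a b, ContDiffAt ℂ 1 (fun w => M w a b) z) :
    ContDiffAt ℂ 1 (fun w => (M w).det) z := by
  simp only [Matrix.det_apply]
  exact ContDiffAt.sum fun σ _ => (contDiffAt_prod fun i _ => h (σ i) i).const_smul _

theorem deriv_eval_ne_zero_of_rootMultiplicity {p : Polynomial ℂ} {μ : ℂ}
    (h : p.rootMultiplicity μ = 1) : p.eval μ = 0 ∧ p.derivative.eval μ ≠ 0 := by
  have hp : p ≠ 0 := by rintro rfl; simp at h
  refine ⟨(Polynomial.rootMultiplicity_pos hp).1 (by omega), fun h2 => ?_⟩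
  have := (Polynomial.one_lt_rootMultiplicity_iff_isRoot hp).2
    ⟨(Polynomial.rootMultiplicity_pos hp).1 (by omega), h2⟩
  omega

theorem norm_freqVec_add_sq (k : Freq) (j : E3) (hj : ‖j‖ = 1) (ε : ℝ) :
    ‖freqVec k + ε • j‖ ^ 2 = ‖freqVec k‖ ^ 2 + 2 * ε * ⟪freqVec k, j⟫_ℝ + ε ^ 2 := by
  rw [norm_add_sq_real, norm_smul, hj, inner_smul_right, Real.norm_eq_abs, mul_one, sq_abs]
  ring

/-- The symbol `(k · j) / |k|`. -/
noncomputable def symbK (j : E3) (k : Freq) : X3 →L[ℂ] X3 :=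
  ((‖freqVec k‖⁻¹ * ⟪freqVec k, j⟫_ℝ : ℝ) : ℂ) • ContinuousLinearMap.id ℂ X3

theorem norm_symbK_le (j : E3) (k : Freq) : ‖symbK j k‖ ≤ ‖j‖ := by
  rw [symbK, norm_smul, Complex.norm_real, norm_mul, norm_inv, norm_norm]
  have h1 := abs_real_inner_le_norm (freqVec k) j
  have h2 : ‖freqVec k‖⁻¹ * ‖⟪freqVec k, j⟫_ℝ‖ ≤ ‖j‖ := by
    rcases (norm_nonneg (freqVec k)).eq_or_lt with h | h
    · rw [← h]; simp
    · rw [inv_mul_le_iff₀ h]; exact h1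
  calc _ ≤ ‖j‖ * 1 := by gcongr; exact ContinuousLinearMap.norm_id_le
    _ = _ := mul_one _

/-- The multiplier with symbol `(k · j) / |k|`. -/
noncomputable def opK (j : E3) : Coef →L[ℂ] Coef := mult (symbK j) ‖j‖ (norm_symbK_le j)

/-- The operator `f ↦ i j × f`. -/
noncomputable def opJ (j : E3) : Coef →L[ℂ] Coef :=
  mult (fun _ => Complex.I • crossX (toC3 j)) _ fun _ => le_rfl

/-- The inclusion of constant fields. -/
noncomputable def constCoef : X3 →L[ℂ] Coef :=
  lp.singleContinuousLinearMap ℂ (fun _ : Freq => X3) 2 0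

theorem constCoef_apply_zero (v : X3) : constCoef v 0 = v :=
  lp.single_apply_self (E := fun _ : Freq => X3) 2 0 v

theorem constCoef_apply_ne (v : X3) {k : Freq} (hk : k ≠ 0) : constCoef v k = 0 :=
  lp.single_apply_ne (E := fun _ : Freq => X3) 2 0 v hk

/-- The mean value. -/
noncomputable def meanCoef : Coef →L[ℂ] X3 := lp.evalCLM ℂ (fun _ : Freq => X3) 2 0

section Modal

variable (B : Coef →L[ℂ] Coef) (j : E3)

/-- The right-hand side `R(ε)` of the modal cell problem. -/
noncomputable def modalSource (z : ℂ × ℂ) : Coef →L[ℂ] Coef :=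
  opN * opP * B + z.1 • (opN * opN * opJ j * B)

/-- The operator `T(ε, λ)` of the modal cell problem. -/
noncomputable def modalOp (z : ℂ × ℂ) : Coef →L[ℂ] Coef :=
  1 + (z.1 * (z.2 + z.1)) • (opN * opN) + (2 * z.1) • (opN * opK j) - modalSource B j z

/-- The fluctuation generated by a constant field. -/
noncomputable def modalSol (z : ℂ × ℂ) : X3 →L[ℂ] Coef :=
  (Ring.inverse (modalOp B j z) * modalSource B j z) ∘L constCoef

/-- The effective matrix of the mean-field equation. -/
noncomputable def meanOp (z : ℂ × ℂ) : X3 →L[ℂ] X3 :=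
  (Complex.I • crossX (toC3 j)) ∘L meanCoef ∘L B ∘L (constCoef + modalSol B j z)

theorem modalSource_zero (l : ℂ) : modalSource B j (0, l) = opN * opP * B := by
  simp [modalSource]

theorem modalOp_zero (l : ℂ) : modalOp B j (0, l) = 1 - opN * opP * B := by
  simp [modalOp, modalSource_zero]

theorem contDiff_modalSource : ContDiff ℂ 1 (modalSource B j) := by
  unfold modalSource; fun_prop

theorem contDiff_modalOp : ContDiff ℂ 1 (modalOp B j) := by
  have := contDiff_modalSource B j
  unfold modalOp; fun_prop

variable {B j}

/-- At ε = 0 the modal operator is the cell operator for every λ, so its invertibility is the only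
input; inversion is smooth near a unit and the rest is polynomial in z. -/
theorem contDiffAt_meanOp (hU : IsUnit (1 - opN * opP * B)) (l : ℂ) :
    ContDiffAt ℂ 1 (meanOp B j) (0, l) := by
  have h1 : ContDiffAt ℂ 1 (fun z => Ring.inverse (modalOp B j z)) (0, l) := by
    rw [← modalOp_zero B j l] at hU
    obtain ⟨u, hu⟩ := hU
    have h0 : ContDiffAt ℂ 1 Ring.inverse (modalOp B j (0, l)) := by
      rw [← hu]
      exact contDiffAt_ringInverse ℂ u
    exact h0.comp (0, l) (contDiff_modalOp B j).contDiffAt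
  have h2 : ContDiffAt ℂ 1 (modalSol B j) (0, l) :=
    (h1.clm_comp (contDiff_modalSource B j).contDiffAt).clm_comp contDiffAt_const
  have h3 : ContDiffAt ℂ 1 (fun z => constCoef + modalSol B j z) (0, l) :=
    contDiffAt_const.add h2
  have h4 : ContDiffAt ℂ 1 (fun _ : ℂ × ℂ => (Complex.I • crossX (toC3 j)) ∘L meanCoef ∘L B)
    (0, l) := contDiffAt_const
  exact h4.clm_comp h3

theorem modalSol_spec {z : ℂ × ℂ} (hz : IsUnit (modalOp B j z)) (v : X3) :
    modalOp B j z (modalSol B j z v) = modalSource B j z (constCoef v) := by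
  have := congrArg (fun L : Coef →L[ℂ] Coef => L (modalSource B j z (constCoef v)))
    (Ring.mul_inverse_cancel _ hz)
  simpa [modalSol] using this

theorem symbN_apply (k : Freq) (x : X3) : symbN k x = ((‖freqVec k‖⁻¹ : ℝ) : ℂ) • x := rfl

theorem symbK_apply (k : Freq) (x : X3) :
    symbK j k x = ((‖freqVec k‖⁻¹ * ⟪freqVec k, j⟫_ℝ : ℝ) : ℂ) • x := rfl

theorem symbP_apply (k : Freq) (x : X3) : symbP k x =
    (((‖freqVec k‖⁻¹ : ℝ) : ℂ) * Complex.I) • crossX (toC3 (freqVec k)) x := rfl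

/-- The modal cell problem, frequency by frequency. -/
theorem modalOp_coef_eq {ε l : ℂ} {S : Coef} {v : X3}
    (h : modalOp B j (ε, l) S = modalSource B j (ε, l) (constCoef v)) (k : Freq) :
    S k + (ε * (l + ε)) • symbN k (symbN k (S k)) + (2 * ε) • symbN k (symbK j k (S k)) =
      symbN k (symbP k (B (constCoef v + S) k)) +
        ε • symbN k (symbN k ((Complex.I • crossX (toC3 j)) (B (constCoef v + S) k))) := by
  have h1 := congrArg (fun f : Coef => f k) h
  have h2 : modalOp B j (ε, l) S k = S k + (ε * (l + ε)) • symbN k (symbN k (S k)) +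
      (2 * ε) • symbN k (symbK j k (S k)) - (symbN k (symbP k (B S k)) +
        ε • symbN k (symbN k ((Complex.I • crossX (toC3 j)) (B S k)))) := rfl
  have h3 : modalSource B j (ε, l) (constCoef v) k = symbN k (symbP k (B (constCoef v) k)) +
        ε • symbN k (symbN k ((Complex.I • crossX (toC3 j)) (B (constCoef v) k))) := rfl
  have h4 : B (constCoef v + S) k = B (constCoef v) k + B S k := by rw [map_add]; rfl
  simp only [h2, h3] at h1
  rw [h4]
  simp only [map_add, smul_add]
  rw [sub_eq_iff_eq_add] at h1
  rw [h1]
  abel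

theorem toC3_add_smul (w j : E3) (ε : ℝ) : toC3 (w + ε • j) = toC3 w + (ε : ℂ) • toC3 j := by
  ext i; simp [toC3]

/-- For small `j`, a simple unstable eigenvalue of the mean-field matrix yields an unstable mode. -/
theorem exists_unstable_coef (hU : IsUnit (1 - opN * opP * B))
    (hmean : ∀ v, B (constCoef v) 0 = 0) (hj : ‖j‖ = 1) (A : Matrix (Fin 3) (Fin 3) ℂ)
    (hA : ∀ (i : Fin 3) (S : Coef),
      S = opN (opP (B (constCoef (EuclideanSpace.single i 1) + S))) →
      A.mulVec (Pi.single i 1) = (Complex.I • crossX (toC3 j) (B S 0)).ofLp)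
    {μ : ℂ} (hμ : A.charpoly.rootMultiplicity μ = 1) (hre : 0 < μ.re) :
    ∃ ε : ℝ, 0 < ε ∧ ε ≤ 1 ∧ ∃ p : ℂ, 0 < p.re ∧ ∃ H : Coef, H ≠ 0 ∧ ∀ k,
      Complex.I • crossX (toC3 (freqVec k + ε • j)) (B H k)
        - ((‖freqVec k + ε • j‖ ^ 2 : ℝ) : ℂ) • H k = p • H k := by
  set Mat : ℂ × ℂ → Matrix (Fin 3) (Fin 3) ℂ := fun z =>
    Matrix.of fun a b => meanOp B j z (EuclideanSpace.single b 1) a with hMat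
  have hMatv : ∀ z (v : X3), (Mat z).mulVec v.ofLp = (meanOp B j z v).ofLp := by
    intro z v
    have hv : v = ∑ b, v b • EuclideanSpace.single b (1 : ℂ) := by
      ext i; fin_cases i <;> simp [Fin.sum_univ_three]
    conv_rhs => rw [hv]
    ext a
    simp [Matrix.mulVec, dotProduct, hMat, Fin.sum_univ_three, mul_comm]
  set F : ℂ × ℂ → ℂ := fun z => (Matrix.scalar (Fin 3) (z.2 + z.1) - Mat z).det with hF
  have hFd : ContDiffAt ℂ 1 F (0, μ) := by
    have hm := contDiffAt_meanOp (j := j) hU μ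
    have hent : ∀ a b, ContDiffAt ℂ 1 (fun z => Mat z a b) (0, μ) := fun a b =>
      ((EuclideanSpace.proj a : X3 →L[ℂ] ℂ).contDiff.contDiffAt).comp _
        (hm.clm_apply contDiffAt_const)
    have hent' : ∀ a b, ContDiffAt ℂ 1
        (fun z : ℂ × ℂ => (Matrix.scalar (Fin 3) (z.2 + z.1) - Mat z) a b) (0, μ) := by
      intro a b
      simp only [Matrix.sub_apply]
      refine ContDiffAt.sub ?_ (hent a b)
      simp only [Matrix.scalar_apply, Matrix.diagonal_apply]
      split_ifs <;> fun_prop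
    exact contDiffAt_det hent'
  -- At ε = 0 the fluctuation solves the cell problem, and the constant part contributes nothing
  -- because `hmean` kills the mean of B applied to constants.
  have hMat0 : ∀ l, Mat (0, l) = A := by
    intro l
    refine Matrix.ext_of_mulVec_single fun i => ?_
    have h1 := hMatv (0, l) (EuclideanSpace.single i 1)
    have hsp := modalSol_spec (B := B) (j := j) (z := (0, l)) (by rwa [modalOp_zero])
      (EuclideanSpace.single i 1)
    set S := modalSol B j (0, l) (EuclideanSpace.single i 1)
    have hS : S = opN (opP (B (constCoef (EuclideanSpace.single i 1) + S))) := by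
      rw [modalOp_zero, modalSource_zero] at hsp
      have : S - opN (opP (B S)) = opN (opP (B (constCoef (EuclideanSpace.single i 1)))) := hsp
      rw [sub_eq_iff_eq_add] at this
      simpa only [map_add] using this
    have h2 := hA _ S hS
    have h3 : meanOp B j (0, l) (EuclideanSpace.single i 1) =
        Complex.I • crossX (toC3 j) (B S 0) := by
      have : meanOp B j (0, l) (EuclideanSpace.single i 1) = Complex.I • crossX (toC3 j)
        (B (constCoef (EuclideanSpace.single i 1) + S) 0) := rfl
      rw [this, map_add, lp.coeFn_add, Pi.add_apply, hmean, zero_add]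
    rw [h3, ← h2] at h1
    exact h1
  have hF0 : ∀ l, F (0, l) = A.charpoly.eval l := by
    intro l
    rw [Matrix.eval_charpoly]
    simp [hF, hMat0]
  obtain ⟨hroot, hder⟩ := deriv_eval_ne_zero_of_rootMultiplicity hμ
  have hN : {z : ℂ × ℂ | IsUnit (modalOp B j z) ∧ 0 < z.2.re} ∈ 𝓝 ((0 : ℂ), μ) := by
    refine Filter.inter_mem ?_ ?_
    · have ho : IsOpen {L : Coef →L[ℂ] Coef | IsUnit L} := Units.isOpen
      refine (ho.preimage (contDiff_modalOp B j).continuous).mem_nhds ?_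
      show IsUnit (modalOp B j (0, μ))
      rwa [modalOp_zero]
    · exact (isOpen_lt continuous_const (Complex.continuous_re.comp continuous_snd)).mem_nhds hre
  have hev := eventually_exists_zero hFd (by rw [hF0, hroot])
    (by simp only [hF0, Polynomial.deriv]; exact hder) hN
  -- The zero exists for all small real ε; restricting to the right of 0 allows a choice in (0, 1].
  obtain ⟨ε, ⟨l, ⟨hunit, hl⟩, hFz⟩, hε0, hε1⟩ :=
    ((hev.filter_mono nhdsWithin_le_nhds).and (Ioc_mem_nhdsGT (zero_lt_one (α := ℝ)))).exists
  refine ⟨ε, hε0, hε1, ε * l, by simpa using mul_pos hε0 hl, ?_⟩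
  obtain ⟨v', hv'0, hv'⟩ := Matrix.exists_mulVec_eq_zero_iff.2 hFz
  set v : X3 := WithLp.toLp 2 v' with hv
  have hsp := modalSol_spec hunit v
  set S := modalSol B j ((ε : ℂ), l) v with hSdef
  have hcoef := modalOp_coef_eq hsp
  -- Every term of the modal equation except S₀ itself carries the factor |0|⁻¹ = 0.
  have hS0 : S 0 = 0 := by
    have := hcoef 0
    simpa [symbN_apply] using this
  refine ⟨constCoef v + S, fun h => hv'0 ?_, fun k => ?_⟩
  · have : (constCoef v + S) 0 = v := by
      rw [lp.coeFn_add, Pi.add_apply, constCoef_apply_zero, hS0, add_zero]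
    rw [h] at this
    have h0 : v = 0 := this.symm
    simpa [hv] using h0
  -- Zero mode: the null vector gives ε(λ + ε)v for the curl term, and subtracting |εj|²v = ε²v
  -- leaves ελv = pv.
  rcases eq_or_ne k 0 with rfl | hk
  · have hm : meanOp B j ((ε : ℂ), l) v =
        Complex.I • crossX (toC3 j) (B (constCoef v + S) 0) := rfl
    have h1 : meanOp B j ((ε : ℂ), l) v = (l + ε) • v := by
      rw [Matrix.sub_mulVec] at hv'
      have h2 := hMatv ((ε : ℂ), l) v
      have h3 : (Mat ((ε : ℂ), l)).mulVec v' = (l + ε) • v' := by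
        rw [← sub_eq_zero.1 hv']
        ext i
        simp [Matrix.scalar_apply, Matrix.mulVec_diagonal]
      ext i
      rw [← h2, hv, h3]
      rfl
    rw [freqVec_zero, zero_add, norm_smul, hj, mul_one, Real.norm_eq_abs, sq_abs,
      lp.coeFn_add, Pi.add_apply, constCoef_apply_zero, hS0, add_zero]
    have h4 : toC3 (ε • j) = (ε : ℂ) • toC3 j := by ext i; simp [toC3]
    rw [h4, map_smul, smul_apply, smul_comm, ← hm, h1, smul_smul,
      ← sub_smul]
    congr 1
    push_cast
    ring
  · have hne : ((‖freqVec k‖ : ℝ) : ℂ) ≠ 0 := by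
      have := one_le_norm_freqVec hk
      exact_mod_cast (by linarith : (0 : ℝ) < ‖freqVec k‖).ne'
    -- Multiplication by |k|² undoes the normalization of the modal cell problem. The coefficient of
    -- S becomes |k|² + 2ε k·j + ε² + ελ = |k + εj|² + p.
    have h1 := congrArg (fun x : X3 => (((‖freqVec k‖ : ℝ) : ℂ) ^ 2) • x) (hcoef k)
    have h2 : (constCoef v + S) k = S k := by
      rw [lp.coeFn_add, Pi.add_apply, constCoef_apply_ne v hk, zero_add]
    rw [h2, norm_freqVec_add_sq k j hj, toC3_add_smul, map_add, map_smul]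
    generalize B (constCoef v + S) k = b at *
    generalize S k = s at *
    have h3 : (((‖freqVec k‖ : ℝ) : ℂ) ^ 2) • (s + ((ε : ℂ) * (l + ε)) • symbN k (symbN k s) +
        (2 * (ε : ℂ)) • symbN k (symbK j k s)) =
        (((‖freqVec k‖ : ℝ) : ℂ) ^ 2 + ε * (l + ε) + 2 * ε * (⟪freqVec k, j⟫_ℝ : ℂ)) • s := by
      simp only [symbN_apply, symbK_apply, smul_smul, ← add_smul, smul_add]
      congr 1
      push_cast
      field_simp
    have h4 : (((‖freqVec k‖ : ℝ) : ℂ) ^ 2) • (symbN k (symbP k b) +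
        (ε : ℂ) • symbN k (symbN k ((Complex.I • crossX (toC3 j)) b))) =
        Complex.I • (crossX (toC3 (freqVec k)) + (ε : ℂ) • crossX (toC3 j)) b := by
      simp only [symbN_apply, symbP_apply, smul_smul, smul_add, smul_apply, add_apply]
      congr 2
      · push_cast
        field_simp
      · push_cast
        field_simp
    simp only [h3, h4] at h1
    rw [← h1, ← sub_smul]
    congr 1
    push_cast
    ring

end Modal

end
-- The torus, its measure and the exponentials
section

open scoped InnerProductSpace ComplexConjugate

/-- The standard torus `(ℝ / ℤ)³`. -/
abbrev Torus : Type := UnitAddTorus (Fin 3)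

/-- The Haar probability measure of the torus. -/
noncomputable abbrev torusMeasure : Measure Torus :=
  Measure.pi fun _ => AddCircle.haarAddCircle (T := (1 : ℝ))

/-- The factor `(2π)⁻¹`. -/
noncomputable def invTwoPi : ENNReal := ENNReal.ofReal (2 * Real.pi)⁻¹

theorem invTwoPi_ne_zero : invTwoPi ≠ 0 := by
  have : 0 < Real.pi := Real.pi_pos
  simp only [invTwoPi, ne_eq, ENNReal.ofReal_eq_zero, not_le]
  positivity

theorem invTwoPi_ne_top : invTwoPi ≠ ⊤ := ENNReal.ofReal_ne_top

/-- Lebesgue measure on the cell, normalized to total mass one. -/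
noncomputable def cellMeasure : Measure E3 := invTwoPi ^ 3 • volume.restrict cell

/-- The section `ℝ / ℤ → [0, 2π)`. -/
noncomputable def circleLift (t : UnitAddCircle) : ℝ :=
  2 * Real.pi * (AddCircle.equivIco (1 : ℝ) 0 t : ℝ)

/-- The section `(ℝ / ℤ)³ → [0, 2π)³`. -/
noncomputable def cellLift (t : Torus) : E3 := WithLp.toLp 2 fun i => circleLift (t i)

/-- The projection `ℝ³ → (ℝ / ℤ)³`, `x ↦ x / 2π`. -/
noncomputable def torusMk (x : E3) : Torus := fun i => ((x i / (2 * Real.pi) : ℝ) : UnitAddCircle)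

theorem circleLift_mem (t : UnitAddCircle) : circleLift t ∈ Set.Ico 0 (2 * Real.pi) := by
  have h := (AddCircle.equivIco (1 : ℝ) 0 t).2
  simp only [zero_add, Set.mem_Ico] at h
  have hp := Real.pi_pos
  refine ⟨mul_nonneg (by positivity) h.1, ?_⟩
  calc circleLift t < 2 * Real.pi * 1 := mul_lt_mul_of_pos_left h.2 (by positivity)
    _ = _ := mul_one _

theorem cellLift_mem (t : Torus) : cellLift t ∈ cell := fun i => circleLift_mem (t i)

theorem coe_circleLift_div (t : UnitAddCircle) :
    ((circleLift t / (2 * Real.pi) : ℝ) : UnitAddCircle) = t := by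
  have hp : 2 * Real.pi ≠ 0 := by positivity
  rw [circleLift, mul_div_cancel_left₀ _ hp]
  exact AddCircle.coe_equivIco

theorem torusMk_cellLift (t : Torus) : torusMk (cellLift t) = t :=
  funext fun i => coe_circleLift_div (t i)

theorem circleLift_coe {x : ℝ} (hx : x ∈ Set.Ico 0 (2 * Real.pi)) :
    circleLift ((x / (2 * Real.pi) : ℝ) : UnitAddCircle) = x := by
  have hp : 0 < 2 * Real.pi := by positivity
  rw [circleLift, AddCircle.equivIco_coe_of_mem (p := (1 : ℝ)) (a := 0)]
  · field_simp
  · refine ⟨div_nonneg hx.1 hp.le, ?_⟩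
    rw [zero_add, div_lt_one hp]
    exact hx.2

theorem cellLift_torusMk {x : E3} (hx : x ∈ cell) : cellLift (torusMk x) = x := by
  ext i; exact circleLift_coe (hx i)

theorem torusMk_add (x y : E3) : torusMk (x + y) = torusMk x + torusMk y := by
  funext i
  simp [torusMk, add_div]

theorem torusMk_add_single (i : Fin 3) (x : E3) :
    torusMk (x + EuclideanSpace.single i (2 * Real.pi)) = torusMk x := by
  have hp : 2 * Real.pi ≠ 0 := by positivity
  rw [torusMk_add]
  convert add_zero _
  funext a
  by_cases h : a = i
  · subst h
    simp only [torusMk, PiLp.single_apply, if_true, div_self hp, Pi.zero_apply]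
    exact AddCircle.coe_period (1 : ℝ)
  · simp [torusMk, h]

theorem isPeriodic_comp_torusMk {β : Type*} (f : Torus → β) : IsPeriodic fun x => f (torusMk x) :=
  fun i x => by simp only [torusMk_add_single]

theorem IsPeriodic.eq_of_torusMk_eq {β : Type*} {g : E3 → β} (hg : IsPeriodic g) {x y : E3}
    (h : torusMk x = torusMk y) : g x = g y := by
  have hp : 2 * Real.pi ≠ 0 := by positivity
  have h1 : ∀ i, ∃ n : ℤ, x i = y i + n * (2 * Real.pi) := by
    intro i
    have h2 : ((x i / (2 * Real.pi) - y i / (2 * Real.pi) : ℝ) : UnitAddCircle) = 0 := by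
      rw [AddCircle.coe_sub]
      exact sub_eq_zero.2 (congrFun h i)
    obtain ⟨n, hn⟩ := (AddCircle.coe_eq_zero_iff (1 : ℝ)).1 h2
    refine ⟨n, ?_⟩
    rw [zsmul_eq_mul, mul_one] at hn
    field_simp at hn
    linarith
  choose n hn using h1
  have hper : ∀ i, Function.Periodic g (n i • EuclideanSpace.single i (2 * Real.pi)) := fun i =>
    Function.Periodic.zsmul (fun z => hg i z) (n i)
  have hsum := ((hper 0).add_period (hper 1)).add_period (hper 2)
  have : x = y + (n 0 • EuclideanSpace.single 0 (2 * Real.pi) +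
      n 1 • EuclideanSpace.single 1 (2 * Real.pi) +
      n 2 • EuclideanSpace.single 2 (2 * Real.pi)) := by
    ext i
    fin_cases i <;> simp [hn]
  rw [this, hsum]

theorem measurableSet_cell : MeasurableSet cell := by
  have : cell = ⋂ i : Fin 3, (fun x : E3 => x i) ⁻¹' Set.Ico 0 (2 * Real.pi) := by
    ext; simp [cell]
  rw [this]
  exact MeasurableSet.iInter fun i => measurableSet_Ico.preimage (by fun_prop)

theorem measurable_circleLift : Measurable circleLift :=
  measurable_const.mul (measurable_subtype_coe.comp (AddCircle.measurableEquivIco 1 0).measurable)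

theorem measurePreserving_circleLift : MeasurePreserving circleLift
    (AddCircle.haarAddCircle (T := (1 : ℝ)))
    (invTwoPi • volume.restrict (Set.Ico 0 (2 * Real.pi))) := by
  have hp : 0 < 2 * Real.pi := by positivity
  refine ⟨measurable_circleLift, ?_⟩
  have h1 : AddCircle.haarAddCircle (T := (1 : ℝ)) =
      Measure.map ((↑) : ℝ → UnitAddCircle) (volume.restrict (Set.Ico 0 1)) := by
    have := (AddCircle.measurePreserving_mk (1 : ℝ) 0).map_eq
    rw [AddCircle.volume_eq_smul_haarAddCircle, ENNReal.ofReal_one, one_smul, zero_add] at this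
    rw [← this, ← restrict_Ico_eq_restrict_Ioc]
  rw [h1, Measure.map_map measurable_circleLift AddCircle.measurable_mk']
  have h2 : circleLift ∘ ((↑) : ℝ → UnitAddCircle) =ᵐ[volume.restrict (Set.Ico 0 1)]
      fun x => 2 * Real.pi * x := by
    filter_upwards [ae_restrict_mem measurableSet_Ico] with x hx
    have := circleLift_coe (x := 2 * Real.pi * x) ⟨mul_nonneg hp.le hx.1, by
      nlinarith [mul_lt_mul_of_pos_left hx.2 hp]⟩
    rwa [mul_div_cancel_left₀ _ hp.ne'] at this
  rw [Measure.map_congr h2]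
  have h3 : Set.Ico (0 : ℝ) 1 = (fun x => 2 * Real.pi * x) ⁻¹' Set.Ico 0 (2 * Real.pi) := by
    ext x
    simp only [Set.mem_Ico, Set.mem_preimage]
    constructor
    · rintro ⟨h, h'⟩; exact ⟨by positivity, by nlinarith⟩
    · rintro ⟨h, h'⟩
      exact ⟨nonneg_of_mul_nonneg_right h hp, by nlinarith⟩
  rw [h3, ← Measure.restrict_map (by fun_prop) measurableSet_Ico,
    Real.map_volume_mul_left hp.ne', Measure.restrict_smul, abs_of_pos (inv_pos.2 hp), invTwoPi]

/-- Transports Haar measure and the Fourier basis of (ℝ/ℤ)³ to the cell. It is the product of the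
one-dimensional statements, followed by the identification of ℝ³ with its Euclidean version. -/
theorem measurePreserving_cellLift : MeasurePreserving cellLift torusMeasure cellMeasure := by
  have h1 := measurePreserving_pi (ι := Fin 3)
    (fun _ => AddCircle.haarAddCircle (T := (1 : ℝ)))
    (fun _ => invTwoPi • volume.restrict (Set.Ico 0 (2 * Real.pi)))
    (hν := fun _ => by
      have := Measure.smul_finite (volume.restrict (Set.Ico 0 (2 * Real.pi))) invTwoPi_ne_top
      infer_instance)
    (fun _ => measurePreserving_circleLift)
  have h2 : Measure.pi (fun _ : Fin 3 => invTwoPi • volume.restrict (Set.Ico 0 (2 * Real.pi))) =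
      invTwoPi ^ 3 • (volume : Measure (Fin 3 → ℝ)).restrict
        (Set.univ.pi fun _ => Set.Ico 0 (2 * Real.pi)) := by
    have := Measure.smul_finite (volume.restrict (Set.Ico 0 (2 * Real.pi))) invTwoPi_ne_top
    rw [volume_pi, Measure.restrict_pi_pi]
    refine Measure.pi_eq fun s hs => ?_
    simp [Fin.prod_univ_three]
    ring
  rw [h2] at h1
  have h3 : MeasurePreserving (@WithLp.toLp 2 (Fin 3 → ℝ))
      (invTwoPi ^ 3 • (volume : Measure (Fin 3 → ℝ)).restrict
        (Set.univ.pi fun _ => Set.Ico 0 (2 * Real.pi))) cellMeasure := by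
    have h4 := ((PiLp.volume_preserving_toLp (Fin 3)).restrict_preimage
      measurableSet_cell).smul_measure (invTwoPi ^ 3)
    have h5 : (@WithLp.toLp 2 (Fin 3 → ℝ)) ⁻¹' cell =
        Set.univ.pi fun _ => Set.Ico 0 (2 * Real.pi) := by
      ext; simp [cell]
    rwa [h5] at h4
  exact h3.comp h1

instance : IsProbabilityMeasure cellMeasure :=
  ⟨by rw [← measurePreserving_cellLift.measure_preimage MeasurableSet.univ.nullMeasurableSet,
    Set.preimage_univ, measure_univ]⟩

theorem volume_cell : volume cell = (invTwoPi ^ 3)⁻¹ := by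
  have h : cellMeasure Set.univ = 1 := measure_univ
  rw [cellMeasure, Measure.smul_apply, Measure.restrict_apply_univ, smul_eq_mul, mul_comm] at h
  exact ENNReal.eq_inv_of_mul_eq_one_left h

theorem restrict_cell_eq : volume.restrict cell = (invTwoPi ^ 3)⁻¹ • cellMeasure := by
  rw [cellMeasure, smul_smul, ENNReal.inv_mul_cancel (pow_ne_zero _ invTwoPi_ne_zero)
    (ENNReal.pow_ne_top invTwoPi_ne_top), one_smul]

theorem average_cell {E : Type*} [NormedAddCommGroup E] [NormedSpace ℝ E] (f : E3 → E) :
    ⨍ x in cell, f x = ∫ x, f x ∂cellMeasure := by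
  rw [average, cellMeasure, Measure.restrict_apply_univ, volume_cell, inv_inv]

/-- The volume `(2π)³` of the torus. -/
noncomputable def cellVolume : ℝ := ((invTwoPi ^ 3)⁻¹).toReal

theorem cellVolume_pos : 0 < cellVolume :=
  ENNReal.toReal_pos (ENNReal.inv_ne_zero.2 (ENNReal.pow_ne_top invTwoPi_ne_top))
    (ENNReal.inv_ne_top.2 (pow_ne_zero _ invTwoPi_ne_zero))

theorem setIntegral_cell {E : Type*} [NormedAddCommGroup E] [NormedSpace ℝ E] (f : E3 → E) :
    ∫ x in cell, f x = cellVolume • ∫ x, f x ∂cellMeasure := by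
  rw [restrict_cell_eq, integral_smul_measure, cellVolume]

theorem ae_cell_iff {p : E3 → Prop} :
    (∀ᵐ x ∂volume.restrict cell, p x) ↔ ∀ᵐ x ∂cellMeasure, p x :=
  ⟨fun h => Measure.ae_smul_measure h _, fun h => by
    rw [restrict_cell_eq]; exact Measure.ae_smul_measure h _⟩

theorem memLp_cell_iff {E : Type*} [NormedAddCommGroup E] {f : E3 → E} {p : ENNReal} :
    MemLp f p (volume.restrict cell) ↔ MemLp f p cellMeasure :=
  ⟨fun h => h.smul_measure (ENNReal.pow_ne_top invTwoPi_ne_top), fun h => by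
    rw [restrict_cell_eq]
    exact h.smul_measure (ENNReal.inv_ne_top.2 (pow_ne_zero _ invTwoPi_ne_zero))⟩

/-- The integral of a periodic function is invariant under translations. -/
theorem IsPeriodic.integral_add_right {E : Type*} [NormedAddCommGroup E] [NormedSpace ℝ E]
    {g : E3 → E} (hg : IsPeriodic g) (hc : Continuous g) (h : E3) :
    ∫ x, g (x + h) ∂cellMeasure = ∫ x, g x ∂cellMeasure := by
  have h0 : ∀ f : E3 → E, Continuous f →
      ∫ x, f x ∂cellMeasure = ∫ t, f (cellLift t) ∂torusMeasure := fun f hf => by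
    rw [← measurePreserving_cellLift.map_eq,
      integral_map measurePreserving_cellLift.measurable.aemeasurable hf.aestronglyMeasurable]
  rw [h0 _ (by fun_prop), h0 _ hc]
  -- Shifting by h is a group translation on the torus, which preserves Haar measure.
  have h1 : ∀ t, g (cellLift t + h) = g (cellLift (t + torusMk h)) := fun t =>
    hg.eq_of_torusMk_eq (by rw [torusMk_add, torusMk_cellLift, torusMk_cellLift])
  simp only [h1]
  exact MeasureTheory.integral_add_right_eq_self (μ := torusMeasure)
    (fun t => g (cellLift t)) (torusMk h)

/-- The exponential `e^{i k · x}`. -/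
noncomputable def expo (k : Freq) (x : E3) : ℂ :=
  Complex.exp (Complex.I * (k 0 * x 0 + k 1 * x 1 + k 2 * x 2))

theorem mFourier_eq_expo (k : Freq) (t : Torus) :
    UnitAddTorus.mFourier k t = expo k (cellLift t) := by
  have hp : (Real.pi : ℂ) ≠ 0 := by exact_mod_cast Real.pi_ne_zero
  have h : ∀ i, fourier (k i) (t i) = Complex.exp (Complex.I * (k i * (cellLift t i : ℂ))) := by
    intro i
    conv_lhs => rw [← coe_circleLift_div (t i), fourier_coe_apply]
    congr 1
    simp only [cellLift]
    push_cast
    field_simp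
  simp only [UnitAddTorus.mFourier, ContinuousMap.coe_mk, Fin.prod_univ_three, h, expo,
    ← Complex.exp_add]
  congr 1
  ring

theorem continuous_expo (k : Freq) : Continuous (expo k) := by
  unfold expo; fun_prop

theorem norm_expo (k : Freq) (x : E3) : ‖expo k x‖ = 1 := by
  rw [expo, mul_comm]
  exact_mod_cast Complex.norm_exp_ofReal_mul_I (k 0 * x 0 + k 1 * x 1 + k 2 * x 2)

theorem conj_expo (k : Freq) (x : E3) : conj (expo k x) = expo (-k) x := by
  simp only [expo, ← Complex.exp_conj]
  congr 1
  simp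
  ring

theorem expo_mul (k l : Freq) (x : E3) : expo k x * expo l x = expo (k + l) x := by
  simp only [expo, ← Complex.exp_add]
  congr 1
  simp
  ring

theorem expo_zero (x : E3) : expo 0 x = 1 := by simp [expo]

theorem isPeriodic_expo (k : Freq) : IsPeriodic (expo k) := by
  intro i x
  have h1 : expo k (x + EuclideanSpace.single i (2 * Real.pi)) =
      expo k x * expo k (EuclideanSpace.single i (2 * Real.pi)) := by
    simp only [expo, ← Complex.exp_add]
    congr 1
    simp
    ring
  have h2 : expo k (EuclideanSpace.single i (2 * Real.pi)) =
      Complex.exp (k i * (2 * Real.pi * Complex.I)) := by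
    rw [expo]
    congr 1
    fin_cases i <;> simp <;> ring
  rw [h1, h2, Complex.exp_int_mul_two_pi_mul_I, mul_one]

theorem integral_expo (k : Freq) : ∫ x, expo k x ∂cellMeasure = if k = 0 then 1 else 0 := by
  rw [← measurePreserving_cellLift.map_eq,
    integral_map measurePreserving_cellLift.measurable.aemeasurable
      (continuous_expo k).aestronglyMeasurable]
  simp only [← mFourier_eq_expo]
  have h := orthonormal_iff_ite.1 (UnitAddTorus.orthonormal_mFourier (d := Fin 3)) 0 k
  rw [ContinuousMap.inner_toLp] at h
  simp only [UnitAddTorus.mFourier_zero, ContinuousMap.one_apply, map_one, mul_one] at h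
  simp only [eq_comm (a := k)]
  exact h

/-- The exponentials are total in `L²`. -/
theorem ae_eq_zero_of_integral_expo {f : E3 → ℂ} (hf : MemLp f 2 cellMeasure)
    (h : ∀ k, ∫ x, conj (expo k x) * f x ∂cellMeasure = 0) : f =ᵐ[cellMeasure] 0 := by
  have hmp := measurePreserving_cellLift
  have hg : MemLp (fun t => f (cellLift t)) 2 torusMeasure := hf.comp_measurePreserving hmp
  have h1 : hg.toLp = 0 := by
    have := (UnitAddTorus.mFourierBasis (d := Fin 3)).repr.map_eq_zero_iff (x := hg.toLp)
    refine this.1 ?_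
    ext k
    rw [UnitAddTorus.mFourierBasis_repr]
    have h2 : ∫ t, UnitAddTorus.mFourier (-k) t • f (cellLift t) ∂torusMeasure = 0 := by
      rw [← h k, ← hmp.map_eq, integral_map hmp.measurable.aemeasurable (by
        rw [hmp.map_eq]
        exact (Complex.continuous_conj.comp (continuous_expo k)).aestronglyMeasurable.mul hf.1)]
      simp only [mFourier_eq_expo, smul_eq_mul, conj_expo]
    refine Eq.trans (integral_congr_ae ?_) h2
    filter_upwards [hg.coeFn_toLp] with t ht
    rw [ht]
  have h2 : (fun t => f (cellLift t)) =ᵐ[torusMeasure] 0 := by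
    have := hg.coeFn_toLp
    rw [h1] at this
    exact this.symm.trans (Lp.coeFn_zero _ _ _)
  -- A measurable representative is needed so that its zero set is measurable and an
  -- almost-everywhere statement can be pushed forward along `cellLift`.
  obtain ⟨g, hg1, hg2⟩ := hf.1
  have h3 : ∀ᵐ t ∂torusMeasure, g (cellLift t) = 0 := by
    filter_upwards [hmp.quasiMeasurePreserving.ae hg2, h2] with t ht ht2
    rw [← ht]; exact ht2
  have h4 : ∀ᵐ x ∂cellMeasure, g x = 0 := by
    rw [← hmp.map_eq, ae_map_iff hmp.measurable.aemeasurable]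
    · exact h3
    · exact hg1.measurable (measurableSet_singleton 0)
  filter_upwards [hg2, h4] with x h5 h6
  rw [h5, h6]; rfl

end
-- Integration by parts for Lipschitz periodic functions
section

open scoped InnerProductSpace ComplexConjugate Topology

section Periodic

theorem norm_le_of_mem_cell {x : E3} (hx : x ∈ cell) : ‖x‖ ≤ 12 * Real.pi := by
  have hp := Real.pi_pos
  have h : ∀ i, x i ^ 2 ≤ (2 * Real.pi) ^ 2 := fun i => by
    have := hx i
    exact pow_le_pow_left₀ this.1 this.2.le 2
  refine le_of_sq_le_sq ?_ (by positivity)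
  rw [EuclideanSpace.norm_sq_eq, Fin.sum_univ_three]
  simp only [Real.norm_eq_abs, sq_abs]
  nlinarith [h 0, h 1, h 2]

theorem IsPeriodic.exists_bound {E : Type*} [NormedAddCommGroup E] {f : E3 → E}
    (hf : IsPeriodic f) (hc : Continuous f) : ∃ C, ∀ x, ‖f x‖ ≤ C := by
  obtain ⟨C, hC⟩ := (isCompact_closedBall (0 : E3) (12 * Real.pi)).exists_bound_of_continuousOn
    hc.continuousOn
  refine ⟨C, fun x => ?_⟩
  rw [hf.eq_of_torusMk_eq (torusMk_cellLift (torusMk x)).symm]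
  exact hC _ (mem_closedBall_zero_iff.2 (norm_le_of_mem_cell (cellLift_mem _)))

/-- The derivatives of a Lipschitz periodic function have mean zero. -/
theorem integral_fderiv_eq_zero {g : E3 → ℂ} (hg : IsPeriodic g) {K : NNReal}
    (hK : LipschitzWith K g) (v : E3) : ∫ x, fderiv ℝ g x v ∂cellMeasure = 0 := by
  -- Difference quotients have mean zero by translation invariance. They are bounded by K‖v‖ and
  -- converge almost everywhere by Rademacher's theorem, so dominated convergence applies.
  have h1 : ∀ t : ℝ, ∫ x, t⁻¹ • (g (x + t • v) - g x) ∂cellMeasure = 0 := by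
    intro t
    obtain ⟨C, hC⟩ := hg.exists_bound hK.continuous
    have hi : ∀ f : E3 → ℂ, Continuous f → (∀ x, ‖f x‖ ≤ C) → Integrable f cellMeasure :=
      fun f hf hb => Integrable.of_bound hf.aestronglyMeasurable C (Filter.Eventually.of_forall hb)
    have hc := hK.continuous
    rw [integral_smul, integral_sub (hi _ (by fun_prop) fun x => hC _) (hi _ hc hC),
      hg.integral_add_right hc, sub_self, smul_zero]
  have h2 : Filter.Tendsto (fun t : ℝ => ∫ x, t⁻¹ • (g (x + t • v) - g x) ∂cellMeasure) (𝓝[≠] 0)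
      (𝓝 (∫ x, fderiv ℝ g x v ∂cellMeasure)) := by
    refine tendsto_integral_filter_of_dominated_convergence (fun _ => K * ‖v‖) ?_ ?_
      (integrable_const _) ?_
    · have hc := hK.continuous
      exact Filter.Eventually.of_forall fun t => by
        have : Continuous fun x => t⁻¹ • (g (x + t • v) - g x) := by fun_prop
        exact this.aestronglyMeasurable
    · filter_upwards [self_mem_nhdsWithin] with t ht
      refine Filter.Eventually.of_forall fun x => ?_
      have ht : 0 < |t| := abs_pos.2 ht
      rw [norm_smul, norm_inv, Real.norm_eq_abs, inv_mul_le_iff₀ ht]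
      refine (hK.norm_sub_le _ _).trans (le_of_eq ?_)
      rw [add_sub_cancel_left, norm_smul, Real.norm_eq_abs]
      ring
    · have := ae_cell_iff.1 (ae_restrict_of_ae (s := cell) (hK.ae_differentiableAt (μ := volume)))
      filter_upwards [this] with x hx
      have := (hx.hasFDerivAt.hasLineDerivAt v).tendsto_slope_zero
      simpa using this
  simp only [h1] at h2
  exact (tendsto_nhds_unique h2 tendsto_const_nhds)

end Periodic

namespace TorusTest

variable (φ : TorusTest)

theorem differentiable : Differentiable ℝ φ.toFun :=
  φ.smooth.differentiable (by simp)

theorem continuous : Continuous φ.toFun := φ.smooth.continuous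

theorem isPeriodic_fderiv : IsPeriodic (fderiv ℝ φ.toFun) := by
  intro i x
  have h : (fun y : E3 => φ.toFun (y + EuclideanSpace.single i (2 * Real.pi))) = φ.toFun :=
    funext fun y => φ.periodic i y
  rw [← fderiv_comp_add_right, h]

theorem exists_bound : ∃ C, ∀ x, ‖φ.toFun x‖ ≤ C := φ.periodic.exists_bound φ.continuous

theorem exists_lipschitz : ∃ K, LipschitzWith K φ.toFun := by
  obtain ⟨C, hC⟩ := φ.isPeriodic_fderiv.exists_bound (φ.smooth.continuous_fderiv (by simp))
  refine ⟨C.toNNReal, lipschitzWith_of_nnnorm_fderiv_le φ.differentiable fun x => ?_⟩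
  exact NNReal.le_toNNReal_of_coe_le (hC x)

theorem pderiv_apply (a : Fin 3) (x : E3) :
    (φ.pderiv a).toFun x = fderiv ℝ φ.toFun x (EuclideanSpace.single a 1) := rfl

end TorusTest

theorem exists_lipschitz_mul {u w : E3 → ℂ} {K L : NNReal} (hu : LipschitzWith K u)
    (hw : LipschitzWith L w) {C D : ℝ} (hC : ∀ x, ‖u x‖ ≤ C) (hD : ∀ x, ‖w x‖ ≤ D) :
    ∃ M, LipschitzWith M fun x => u x * w x := by
  have hC0 := (norm_nonneg _).trans (hC 0)
  have hD0 := (norm_nonneg _).trans (hD 0)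
  refine ⟨(C * L + D * K).toNNReal, LipschitzWith.of_dist_le_mul fun x y => ?_⟩
  rw [Real.coe_toNNReal _ (by positivity), dist_eq_norm]
  have h1 := hu.dist_le_mul x y
  have h2 := hw.dist_le_mul x y
  rw [dist_eq_norm] at h1 h2
  calc ‖u x * w x - u y * w y‖ = ‖u x * (w x - w y) + (u x - u y) * w y‖ := by congr 1; ring
    _ ≤ ‖u x‖ * ‖w x - w y‖ + ‖u x - u y‖ * ‖w y‖ := by
      refine (norm_add_le _ _).trans ?_
      rw [norm_mul, norm_mul]
    _ ≤ C * (L * dist x y) + (K * dist x y) * D := by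
      gcongr
      · exact hC x
      · exact hD y
    _ = _ := by ring

/-- Integration by parts on the torus for a Lipschitz function against a test function. -/
theorem integral_fderiv_mul {u : E3 → ℂ} (hu : IsPeriodic u) {K : NNReal} (hK : LipschitzWith K u)
    (φ : TorusTest) (a : Fin 3) :
    ∫ x, fderiv ℝ u x (EuclideanSpace.single a 1) * φ.toFun x ∂cellMeasure =
      -∫ x, u x * (φ.pderiv a).toFun x ∂cellMeasure := by
  obtain ⟨L, hL⟩ := φ.exists_lipschitz
  obtain ⟨C, hC⟩ := hu.exists_bound hK.continuous
  obtain ⟨D, hD⟩ := φ.exists_bound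
  obtain ⟨D', hD'⟩ := (φ.pderiv a).exists_bound
  obtain ⟨M, hM⟩ := exists_lipschitz_mul hK hL hC hD
  have hper : IsPeriodic fun x => u x * φ.toFun x := fun i x => by
    simp only [hu i x, φ.periodic i x]
  have h0 := integral_fderiv_eq_zero hper hM (EuclideanSpace.single a 1)
  have hC0 := (norm_nonneg _).trans (hC 0)
  have i1 : Integrable (fun x => fderiv ℝ u x (EuclideanSpace.single a 1) * φ.toFun x)
      cellMeasure := by
    refine Integrable.of_bound ((measurable_fderiv_apply_const ℝ u _).aestronglyMeasurable.mul
      φ.continuous.aestronglyMeasurable) (K * D) (Filter.Eventually.of_forall fun x => ?_)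
    rw [norm_mul]
    have h1 : ‖fderiv ℝ u x (EuclideanSpace.single a 1)‖ ≤ K := by
      refine ((fderiv ℝ u x).le_of_opNorm_le (norm_fderiv_le_of_lipschitz ℝ hK) _).trans ?_
      simp
    exact mul_le_mul h1 (hD x) (norm_nonneg _) K.2
  have i2 : Integrable (fun x => u x * (φ.pderiv a).toFun x) cellMeasure := by
    refine Integrable.of_bound (hK.continuous.mul (φ.pderiv a).continuous).aestronglyMeasurable
      (C * D') (Filter.Eventually.of_forall fun x => ?_)
    rw [norm_mul]
    exact mul_le_mul (hC x) (hD' x) (norm_nonneg _) hC0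
  rw [eq_neg_iff_add_eq_zero, ← integral_add i1 i2, ← h0]
  refine integral_congr_ae ?_
  filter_upwards [ae_cell_iff.1 (ae_restrict_of_ae (s := cell)
    (hK.ae_differentiableAt (μ := volume)))] with x hx
  have := (hx.hasFDerivAt.mul (φ.differentiable x).hasFDerivAt).fderiv
  have e : fderiv ℝ (fun x => u x * φ.toFun x) x =
    u x • fderiv ℝ φ.toFun x + φ.toFun x • fderiv ℝ u x := this
  rw [e]
  simp only [add_apply, smul_apply, smul_eq_mul,
    TorusTest.pderiv_apply]
  ring

/-- The exponential as a test function. -/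
noncomputable def expoTest (k : Freq) : TorusTest where
  toFun := expo k
  smooth := by
    have h : ∀ i : Fin 3, ContDiff ℝ ((⊤ : ℕ∞) : WithTop ℕ∞) fun x : E3 => (x i : ℂ) := fun i =>
      Complex.ofRealCLM.contDiff.comp (EuclideanSpace.proj i : E3 →L[ℝ] ℝ).contDiff
    have := h 0; have := h 1; have := h 2
    unfold expo
    fun_prop
  periodic := isPeriodic_expo k

theorem expoTest_pderiv (k : Freq) (a : Fin 3) (x : E3) :
    ((expoTest k).pderiv a).toFun x = Complex.I * k a * expo k x := by
  have h : ∀ i : Fin 3, HasFDerivAt (fun x : E3 => (x i : ℂ))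
      (Complex.ofRealCLM ∘L (EuclideanSpace.proj i : E3 →L[ℝ] ℝ)) x := fun i =>
    (Complex.ofRealCLM ∘L (EuclideanSpace.proj i : E3 →L[ℝ] ℝ)).hasFDerivAt
  have h2 := ((((h 0).const_mul (k 0 : ℂ)).add ((h 1).const_mul (k 1 : ℂ))).add
    ((h 2).const_mul (k 2 : ℂ))).const_mul Complex.I |>.cexp
  have h3 : fderiv ℝ (expo k) x = _ := h2.fderiv
  show fderiv ℝ (expo k) x (EuclideanSpace.single a 1) = _
  rw [h3]
  simp only [smul_apply, add_apply, ContinuousLinearMap.comp_apply,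
    smul_eq_mul, expo]
  fin_cases a <;> simp <;> ring

end
-- The energy estimate
section

open scoped InnerProductSpace ComplexConjugate Topology

namespace TorusTest

/-- The test function `φ ψ̄`. -/
noncomputable def mulConj (φ ψ : TorusTest) : TorusTest where
  toFun x := φ.toFun x * conj (ψ.toFun x)
  smooth := φ.smooth.mul (Complex.conjCLE.contDiff.comp ψ.smooth)
  periodic := fun i x => by simp only [φ.periodic i x, ψ.periodic i x]

theorem mulConj_apply (φ ψ : TorusTest) (x : E3) :
    (φ.mulConj ψ).toFun x = φ.toFun x * conj (ψ.toFun x) := rfl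

theorem mulConj_pderiv (φ ψ : TorusTest) (a : Fin 3) (x : E3) :
    ((φ.mulConj ψ).pderiv a).toFun x = (φ.pderiv a).toFun x * conj (ψ.toFun x) +
      φ.toFun x * conj ((ψ.pderiv a).toFun x) := by
  have h1 : HasFDerivAt (fun y => conj (ψ.toFun y))
      ((Complex.conjCLE : ℂ →L[ℝ] ℂ) ∘L fderiv ℝ ψ.toFun x) x :=
    (Complex.conjCLE : ℂ →L[ℝ] ℂ).hasFDerivAt.comp x (ψ.differentiable x).hasFDerivAt
  have h2 := ((φ.differentiable x).hasFDerivAt.mul h1).fderiv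
  have h3 : fderiv ℝ (φ.mulConj ψ).toFun x = _ := h2
  rw [pderiv_apply, h3]
  simp only [add_apply, smul_apply, smul_eq_mul, ContinuousLinearMap.comp_apply, pderiv_apply]
  simp
  ring

/-- A trigonometric polynomial as a test function. -/
noncomputable def trig (A : Finset Freq) (c : Freq → ℂ) : TorusTest where
  toFun x := ∑ k ∈ A, c k * expo k x
  smooth := ContDiff.sum fun k _ => contDiff_const.mul (expoTest k).smooth
  periodic := fun i x => by simp only [isPeriodic_expo _ i x]

theorem trig_apply (A : Finset Freq) (c : Freq → ℂ) (x : E3) :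
    (trig A c).toFun x = ∑ k ∈ A, c k * expo k x := rfl

theorem trig_pderiv (A : Finset Freq) (c : Freq → ℂ) (a : Fin 3) (x : E3) :
    ((trig A c).pderiv a).toFun x = ∑ k ∈ A, c k * (Complex.I * k a * expo k x) := by
  have h : HasFDerivAt (fun y => ∑ k ∈ A, c k * expo k y)
      (∑ k ∈ A, c k • fderiv ℝ (expo k) x) x :=
    HasFDerivAt.fun_sum fun k _ => ((expoTest k).differentiable x).hasFDerivAt.const_mul (c k)
  have h3 : fderiv ℝ (trig A c).toFun x = _ := h.fderiv
  rw [pderiv_apply, h3, sum_apply]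
  refine Finset.sum_congr rfl fun k _ => ?_
  rw [← expoTest_pderiv]
  rfl

end TorusTest

section Energy

variable {U : E3 → E3}

/-- The `a`-th component of a real field as a complex-valued function. -/
noncomputable def compC (U : E3 → E3) (a : Fin 3) (x : E3) : ℂ := (U x a : ℂ)

theorem isPeriodic_compC (hU : IsPeriodic U) (a : Fin 3) : IsPeriodic (compC U a) := fun i x => by
  simp only [compC, hU i x]

theorem lipschitz_compC {K : NNReal} (hK : LipschitzWith K U) (a : Fin 3) :
    LipschitzWith K (compC U a) := by
  refine LipschitzWith.of_dist_le_mul fun x y => le_trans ?_ (hK.dist_le_mul x y)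
  rw [dist_eq_norm, dist_eq_norm, compC, compC, ← Complex.ofReal_sub, Complex.norm_real]
  exact PiLp.norm_apply_le (U x - U y) a

theorem fderiv_compC {x : E3} (hx : DifferentiableAt ℝ U x) (b : Fin 3) (v : E3) :
    fderiv ℝ (compC U b) x v = ((fderiv ℝ U x v b : ℝ) : ℂ) := by
  have h := ((Complex.ofRealCLM ∘L (EuclideanSpace.proj b : E3 →L[ℝ] ℝ)).hasFDerivAt
    (x := U x)).comp x hx.hasFDerivAt
  have h2 : fderiv ℝ (compC U b) x = _ := h.fderiv
  rw [h2]
  rfl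

theorem integrable_compC_mul (hU : IsPeriodic U) {K : NNReal} (hK : LipschitzWith K U)
    (a : Fin 3) (φ : TorusTest) :
    Integrable (fun x => compC U a x * φ.toFun x) cellMeasure := by
  have hc := (lipschitz_compC hK a).continuous.mul φ.continuous
  obtain ⟨C, hC⟩ := IsPeriodic.exists_bound (f := fun x => compC U a x * φ.toFun x)
    (fun i x => by simp only [isPeriodic_compC hU a i x, φ.periodic i x]) hc
  exact Integrable.of_bound hc.aestronglyMeasurable C (Filter.Eventually.of_forall hC)

theorem integrable_fderiv_compC_mul {K : NNReal} (hK : LipschitzWith K U)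
    (b : Fin 3) (v : E3) (φ : TorusTest) :
    Integrable (fun x => fderiv ℝ (compC U b) x v * φ.toFun x) cellMeasure := by
  obtain ⟨D, hD⟩ := φ.exists_bound
  refine Integrable.of_bound ((measurable_fderiv_apply_const ℝ _ _).aestronglyMeasurable.mul
    φ.continuous.aestronglyMeasurable) (K * ‖v‖ * D) (Filter.Eventually.of_forall fun x => ?_)
  rw [norm_mul]
  have h1 : ‖fderiv ℝ (compC U b) x v‖ ≤ K * ‖v‖ :=
    (fderiv ℝ (compC U b) x).le_of_opNorm_le
      (norm_fderiv_le_of_lipschitz ℝ (lipschitz_compC hK b)) _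
  exact mul_le_mul h1 (hD x) (norm_nonneg _) (by positivity)

theorem sum_compC_pderiv_eq_zero
    (hU : modalDiv 0 (distOfField fun x => toC3 (U x)) = 0) (φ : TorusTest) :
    ∑ a, ∫ x, compC U a x * (φ.pderiv a).toFun x ∂cellMeasure = 0 := by
  have h := congrFun hU φ
  simp only [modalDiv, Finset.sum_apply, modalD, distOfField, distOf, toC3, PiLp.zero_apply,
    Complex.ofReal_zero, mul_zero, zero_mul, add_zero, Pi.zero_apply, Finset.sum_neg_distrib,
    neg_eq_zero, setIntegral_cell, ← Finset.smul_sum] at h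
  exact (smul_eq_zero.1 h).resolve_left cellVolume_pos.ne'

/-- The curl of a triple of test functions. -/
noncomputable def testCurl (s : Fin 3 → TorusTest) (x : E3) : C3 :=
  ![((s 2).pderiv 1).toFun x - ((s 1).pderiv 2).toFun x,
    ((s 0).pderiv 2).toFun x - ((s 2).pderiv 0).toFun x,
    ((s 1).pderiv 0).toFun x - ((s 0).pderiv 1).toFun x]

/-- The integrand of the energy estimate. -/
noncomputable def energyDensity (U : E3 → E3) (s : Fin 3 → TorusTest) (x : E3) : ℂ :=
  ∑ i, crossProduct (toC3 (U x)) (fun a => (s a).toFun x) i * conj (testCurl s x i)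

/-- The pointwise identity (U × s) · (∇ × s) = U · ∇(|s|²/2) - U · (s · ∇)s in its complex form. As
∇ · s = 0, the last term is written with the derivatives ∂ₐ(sₐ s̄_b). Only real parts agree, since
Re(s̄ ∂s) = ∂|s|²/2. -/
theorem energyDensity_re (s : Fin 3 → TorusTest)
    (hs : ∀ x, ∑ a, ((s a).pderiv a).toFun x = 0) (x : E3) :
    (energyDensity U s x).re = (2⁻¹ * (∑ b, ∑ a,
        compC U a x * (((s b).mulConj (s b)).pderiv a).toFun x) -
      ∑ b, ∑ a, compC U b x * (((s a).mulConj (s b)).pderiv a).toFun x).re := by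
  have h0 := hs x
  rw [Fin.sum_univ_three] at h0
  -- The divergence condition eliminates ∂₂s₂; what remains is a polynomial identity in real and
  -- imaginary parts.
  have h1 := eq_neg_of_add_eq_zero_right h0
  simp only [energyDensity, testCurl, TorusTest.mulConj_pderiv, Fin.sum_univ_three, cross_apply,
    compC, toC3, Matrix.cons_val_zero, Matrix.cons_val_one, Matrix.cons_val]
  rw [h1]
  simp only [Complex.add_re, Complex.sub_re, Complex.mul_re, Complex.add_im, Complex.sub_im,
    Complex.mul_im, Complex.ofReal_re, Complex.ofReal_im, Complex.conj_re, Complex.conj_im,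
    Complex.neg_re, Complex.neg_im, map_sub, map_add, map_neg, Complex.inv_re, Complex.inv_im,
    Complex.re_ofNat, Complex.im_ofNat, Complex.normSq_ofNat]
  ring

theorem re_sum_fderiv_compC_le {c : ℝ} {x : E3} (hx : DifferentiableAt ℝ U x)
    (hc : ‖fderiv ℝ U x‖ ≤ c) (s : Fin 3 → TorusTest) :
    (∑ b, ∑ a, fderiv ℝ (compC U b) x (EuclideanSpace.single a 1) *
      ((s a).mulConj (s b)).toFun x).re ≤ c * ∑ a, ‖(s a).toFun x‖ ^ 2 := by
  simp only [fderiv_compC hx, TorusTest.mulConj_apply]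
  have key : ∀ X : E3, ∑ b, ∑ a, fderiv ℝ U x (EuclideanSpace.single a 1) b * (X a * X b) ≤
      c * ∑ a, X a ^ 2 := by
    intro X
    have h1 : ∑ b, ∑ a, fderiv ℝ U x (EuclideanSpace.single a 1) b * (X a * X b) =
        ⟪X, fderiv ℝ U x X⟫_ℝ := by
      have hX : X = ∑ a, X a • EuclideanSpace.single a (1 : ℝ) := by
        ext i; fin_cases i <;> simp [Fin.sum_univ_three]
      conv_rhs => rw [hX]
      simp [PiLp.inner_apply, Fin.sum_univ_three]
      ring
    have h2 : ∑ a, X a ^ 2 = ‖X‖ ^ 2 := by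
      rw [EuclideanSpace.norm_sq_eq]; simp
    rw [h1, h2]
    calc ⟪X, fderiv ℝ U x X⟫_ℝ ≤ ‖X‖ * ‖fderiv ℝ U x X‖ := real_inner_le_norm _ _
      _ ≤ ‖X‖ * (c * ‖X‖) := by gcongr; exact (fderiv ℝ U x).le_of_opNorm_le hc _
      _ = _ := by ring
  -- The real part of sₐ s̄_b splits into products of real parts and products of imaginary parts, so
  -- the real quadratic bound is used twice.
  have h1 := key (WithLp.toLp 2 fun a => ((s a).toFun x).re)
  have h2 := key (WithLp.toLp 2 fun a => ((s a).toFun x).im)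
  refine le_trans (le_of_eq ?_) ((add_le_add h1 h2).trans (le_of_eq ?_))
  · simp only [Complex.re_sum, Complex.ofReal_re, Complex.ofReal_im, Complex.mul_re, Complex.conj_re,
      Complex.conj_im, ← Finset.sum_add_distrib]
    refine Finset.sum_congr rfl fun b _ => Finset.sum_congr rfl fun a _ => ?_
    ring
  · rw [← mul_add, ← Finset.sum_add_distrib]
    congr 1
    refine Finset.sum_congr rfl fun a _ => ?_
    rw [← Complex.normSq_eq_norm_sq, Complex.normSq_apply]
    ring

theorem integrable_test (φ : TorusTest) : Integrable φ.toFun cellMeasure := by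
  obtain ⟨D, hD⟩ := φ.exists_bound
  exact Integrable.of_bound φ.continuous.aestronglyMeasurable D (Filter.Eventually.of_forall hD)

theorem integrable_norm_sq_test (φ : TorusTest) :
    Integrable (fun x => ‖φ.toFun x‖ ^ 2) cellMeasure := by
  refine (integrable_test (φ.mulConj φ)).norm.congr (Filter.Eventually.of_forall fun x => ?_)
  simp [TorusTest.mulConj_apply, sq]

/-- The energy estimate for smooth divergence-free fields. -/
theorem integral_energyDensity_le (hper : IsPeriodic U) {K : NNReal} (hK : LipschitzWith K U)
    (hdiv : modalDiv 0 (distOfField fun x => toC3 (U x)) = 0) {c : ℝ}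
    (hc : ∀ᵐ x ∂cellMeasure, ‖fderiv ℝ U x‖ ≤ c) (s : Fin 3 → TorusTest)
    (hs : ∀ x, ∑ a, ((s a).pderiv a).toFun x = 0) :
    ∫ x, (energyDensity U s x).re ∂cellMeasure ≤
      c * ∫ x, ∑ a, ‖(s a).toFun x‖ ^ 2 ∂cellMeasure := by
  simp only [energyDensity_re s hs]
  have i1 : Integrable (fun x => 2⁻¹ * (∑ b, ∑ a,
        compC U a x * (((s b).mulConj (s b)).pderiv a).toFun x)) cellMeasure :=
    (integrable_finsetSum _ fun b _ => integrable_finsetSum _ fun a _ =>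
      integrable_compC_mul hper hK a _).const_mul _
  have i2 : ∀ b a, Integrable (fun x => compC U b x *
      (((s a).mulConj (s b)).pderiv a).toFun x) cellMeasure := fun b a =>
    integrable_compC_mul hper hK b _
  have i3 : Integrable (fun x => ∑ b, ∑ a, compC U b x *
      (((s a).mulConj (s b)).pderiv a).toFun x) cellMeasure :=
    integrable_finsetSum _ fun b _ => integrable_finsetSum _ fun a _ => i2 b a
  have i4 : ∀ b a, Integrable (fun x => fderiv ℝ (compC U b) x (EuclideanSpace.single a 1) *
      ((s a).mulConj (s b)).toFun x) cellMeasure := fun b a =>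
    integrable_fderiv_compC_mul hK b _ _
  have i5 : Integrable (fun x => ∑ b, ∑ a, fderiv ℝ (compC U b) x (EuclideanSpace.single a 1) *
      ((s a).mulConj (s b)).toFun x) cellMeasure :=
    integrable_finsetSum _ fun b _ => integrable_finsetSum _ fun a _ => i4 b a
  have h1 : ∫ x, (2⁻¹ * (∑ b, ∑ a,
        compC U a x * (((s b).mulConj (s b)).pderiv a).toFun x) -
      ∑ b, ∑ a, compC U b x * (((s a).mulConj (s b)).pderiv a).toFun x) ∂cellMeasure =
      ∫ x, ∑ b, ∑ a, fderiv ℝ (compC U b) x (EuclideanSpace.single a 1) *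
      ((s a).mulConj (s b)).toFun x ∂cellMeasure := by
    rw [integral_sub i1 i3, integral_const_mul,
      integral_finsetSum _ fun b _ => integrable_finsetSum _ fun a _ =>
        integrable_compC_mul hper hK a _,
      integral_finsetSum _ fun b _ => integrable_finsetSum _ fun a _ => i2 b a,
      integral_finsetSum _ fun b _ => integrable_finsetSum _ fun a _ => i4 b a]
    -- The weak form of ∇ · U = 0 tested against |s_b|².
    have h2 : ∀ b, ∫ x, ∑ a, compC U a x * (((s b).mulConj (s b)).pderiv a).toFun x
        ∂cellMeasure = 0 := fun b => by
      rw [integral_finsetSum _ fun a _ => integrable_compC_mul hper hK a _]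
      exact sum_compC_pderiv_eq_zero hdiv _
    have h3 : ∀ b, ∫ x, ∑ a, compC U b x * (((s a).mulConj (s b)).pderiv a).toFun x ∂cellMeasure =
        -∫ x, ∑ a, fderiv ℝ (compC U b) x (EuclideanSpace.single a 1) *
          ((s a).mulConj (s b)).toFun x ∂cellMeasure := fun b => by
      rw [integral_finsetSum _ fun a _ => i2 b a, integral_finsetSum _ fun a _ => i4 b a,
        ← Finset.sum_neg_distrib]
      refine Finset.sum_congr rfl fun a _ => ?_
      rw [integral_fderiv_mul (isPeriodic_compC hper b) (lipschitz_compC hK b), neg_neg]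
    simp only [h2, h3, Finset.sum_const_zero, mul_zero, zero_sub, Finset.sum_neg_distrib, neg_neg]
  have h4 := integral_re (i1.sub i3)
  have h5 := integral_re i5
  simp only [RCLike.re_eq_complex_re, Pi.sub_apply] at h4 h5
  rw [h4, h1, ← h5, ← integral_const_mul]
  refine integral_mono_ae i5.re ((integrable_finsetSum _ fun a _ =>
    integrable_norm_sq_test (s a)).const_mul c) ?_
  filter_upwards [hc, ae_cell_iff.1 (ae_restrict_of_ae (s := cell)
    (hK.ae_differentiableAt (μ := volume)))] with x hx1 hx2
  exact re_sum_fderiv_compC_le hx2 hx1 s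

end Energy

end
-- Fourier transform of fields and the operator U× on coefficients
section

open scoped InnerProductSpace ComplexConjugate Topology

/-- Square-integrable vector fields on the cell. -/
abbrev FieldL2 : Type := Lp X3 2 cellMeasure

theorem memLp_expo_smul (k : Freq) (v : X3) : MemLp (fun x => expo k x • v) 2 cellMeasure :=
  MemLp.of_bound ((continuous_expo k).smul continuous_const).aestronglyMeasurable ‖v‖
    (Filter.Eventually.of_forall fun x => by rw [norm_smul, norm_expo, one_mul])

/-- The embedding `v ↦ e^{i k · x} v`. -/
noncomputable def modeIso (k : Freq) : X3 →ₗᵢ[ℂ] FieldL2 where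
  toFun v := (memLp_expo_smul k v).toLp
  map_add' v w := by
    rw [← MemLp.toLp_add]
    congr 1
    funext x
    exact smul_add _ _ _
  map_smul' a v := by
    rw [RingHom.id_apply, ← MemLp.toLp_const_smul]
    congr 1
    funext x
    exact smul_comm _ _ _
  norm_map' v := by
    show ‖(memLp_expo_smul k v).toLp‖ = ‖v‖
    rw [Lp.norm_toLp, eLpNorm_congr_norm_ae (g := fun _ : E3 => v)
      (Filter.Eventually.of_forall fun x => by rw [norm_smul, norm_expo, one_mul]),
      eLpNorm_const _ (by norm_num) (NeZero.ne _)]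
    simp

theorem inner_modeIso_left (k : Freq) (v : X3) (F : FieldL2) :
    ⟪modeIso k v, F⟫_ℂ = ∫ x, conj (expo k x) * ⟪v, F x⟫_ℂ ∂cellMeasure := by
  rw [L2.inner_def]
  refine integral_congr_ae ?_
  have : (modeIso k v : E3 → X3) =ᵐ[cellMeasure] fun x => expo k x • v :=
    (memLp_expo_smul k v).coeFn_toLp
  filter_upwards [this] with x hx
  rw [hx, inner_smul_left]

theorem inner_single_one_left (a : Fin 3) (y : X3) : ⟪EuclideanSpace.single a 1, y⟫_ℂ = y a := by
  rw [EuclideanSpace.inner_single_left, map_one, one_mul]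

theorem isHilbertSum_modeIso : IsHilbertSum ℂ (fun _ : Freq => X3) modeIso := by
  refine IsHilbertSum.mk ?_ ?_
  · intro k l hkl v w
    rw [inner_modeIso_left]
    have : (modeIso l w : E3 → X3) =ᵐ[cellMeasure] fun x => expo l x • w :=
      (memLp_expo_smul l w).coeFn_toLp
    have h : ∫ x, conj (expo k x) * ⟪v, modeIso l w x⟫_ℂ ∂cellMeasure =
        ∫ x, expo (-k + l) x * ⟪v, w⟫_ℂ ∂cellMeasure := by
      refine integral_congr_ae ?_
      filter_upwards [this] with x hx
      rw [hx, inner_smul_right, conj_expo, ← mul_assoc, expo_mul]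
    rw [h, integral_mul_const, integral_expo, if_neg, zero_mul]
    rw [neg_add_eq_zero]
    exact hkl
  · rw [top_le_iff, Submodule.topologicalClosure_eq_top_iff, Submodule.eq_bot_iff]
    intro F hF
    have h0 : ∀ k v, ⟪modeIso k v, F⟫_ℂ = 0 := fun k v =>
      (Submodule.mem_orthogonal _ _).1 hF _
        (Submodule.mem_iSup_of_mem k (LinearMap.mem_range_self _ v))
    have h1 : ∀ a, (fun x => F x a) =ᵐ[cellMeasure] 0 := fun a => by
      refine ae_eq_zero_of_integral_expo ((Lp.memLp F).eval_piLp a) fun k => ?_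
      rw [← h0 k (EuclideanSpace.single a 1), inner_modeIso_left]
      simp only [inner_single_one_left]
    refine (Lp.eq_zero_iff_ae_eq_zero).2 ?_
    filter_upwards [h1 0, h1 1, h1 2] with x hx0 hx1 hx2
    ext a
    fin_cases a
    · exact hx0
    · exact hx1
    · exact hx2

/-- The Fourier transform of vector fields on the torus. -/
noncomputable def fourierIso : FieldL2 ≃ₗᵢ[ℂ] Coef := isHilbertSum_modeIso.linearIsometryEquiv

theorem inner_fourierIso_apply (F : FieldL2) (k : Freq) (v : X3) :
    ⟪v, fourierIso F k⟫_ℂ = ∫ x, conj (expo k x) * ⟪v, F x⟫_ℂ ∂cellMeasure := by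
  have h := lp.inner_single_left (G := fun _ : Freq => X3) (𝕜 := ℂ) k v (fourierIso F)
  refine h.symm.trans ?_
  rw [← inner_modeIso_left, ← isHilbertSum_modeIso.linearIsometryEquiv_symm_apply_single,
    ← LinearIsometryEquiv.inner_map_map fourierIso]
  congr 1
  exact (isHilbertSum_modeIso.linearIsometryEquiv.apply_symm_apply _).symm

theorem fourierIso_apply (F : FieldL2) (k : Freq) (a : Fin 3) :
    fourierIso F k a = ∫ x, expo (-k) x * F x a ∂cellMeasure := by
  have h := inner_fourierIso_apply F k (EuclideanSpace.single a 1)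
  simpa only [conj_expo, inner_single_one_left] using h

theorem fourierIso_toLp_apply {f : E3 → X3} (hf : MemLp f 2 cellMeasure) (k : Freq) (a : Fin 3) :
    fourierIso hf.toLp k a = ∫ x, expo (-k) x * f x a ∂cellMeasure := by
  rw [fourierIso_apply]
  refine integral_congr_ae ?_
  filter_upwards [hf.coeFn_toLp] with x hx
  rw [hx]

theorem memLp_of_test (s : Fin 3 → TorusTest) :
    MemLp (fun x => (WithLp.toLp 2 fun a => (s a).toFun x : X3)) 2 cellMeasure := by
  refine memLp_piLp_iff.2 fun a => ?_
  obtain ⟨D, hD⟩ := (s a).exists_bound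
  exact MemLp.of_bound (s a).continuous.aestronglyMeasurable D (Filter.Eventually.of_forall hD)

theorem integral_expo_mul_trig (A : Finset Freq) (c : Freq → ℂ) (k : Freq) :
    ∫ x, expo (-k) x * (TorusTest.trig A c).toFun x ∂cellMeasure = if k ∈ A then c k else 0 := by
  simp only [TorusTest.trig_apply, Finset.mul_sum]
  rw [integral_finsetSum]
  · have : ∀ l, ∫ x, expo (-k) x * (c l * expo l x) ∂cellMeasure = if k = l then c l else 0 := by
      intro l
      have h : ∀ x, expo (-k) x * (c l * expo l x) = c l * expo (-k + l) x := fun x => by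
        rw [← expo_mul]; ring
      simp only [h, integral_const_mul, integral_expo, neg_add_eq_zero, mul_ite, mul_one, mul_zero]
    simp only [this, Finset.sum_ite_eq]
  · intro l _
    have hc : Continuous fun x => expo (-k) x * (c l * expo l x) :=
      (continuous_expo _).mul (continuous_const.mul (continuous_expo _))
    refine Integrable.of_bound hc.aestronglyMeasurable ‖c l‖ (Filter.Eventually.of_forall fun x => ?_)
    simp [norm_expo]

/-- The `L²` field of a trigonometric polynomial has the expected coefficients. -/
theorem fourierIso_trig {A : Finset Freq} {s : Coef} (hs : ∀ k ∉ A, s k = 0)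
    {t : E3 → X3} (ht : MemLp t 2 cellMeasure)
    (hts : ∀ x a, t x a = (TorusTest.trig A fun k => s k a).toFun x) :
    fourierIso ht.toLp = s := by
  ext1
  funext k
  ext a
  rw [fourierIso_toLp_apply]
  simp only [hts, integral_expo_mul_trig]
  split_ifs with h
  · rfl
  · rw [hs k h]; rfl

section Field

variable {U : E3 → E3}

theorem memLp_top_toC3 (hper : IsPeriodic U) {K : NNReal} (hK : LipschitzWith K U) :
    MemLp (fun x => toC3 (U x)) ⊤ cellMeasure := by
  refine memLp_pi_iff.2 fun a => ?_
  obtain ⟨C, hC⟩ := (isPeriodic_compC hper a).exists_bound (lipschitz_compC hK a).continuous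
  exact memLp_top_of_bound (lipschitz_compC hK a).continuous.aestronglyMeasurable C
    (Filter.Eventually.of_forall hC)

/-- The operator `H ↦ U × H` on `L²`. -/
noncomputable def fieldOp (hU : MemLp (fun x => toC3 (U x)) ⊤ cellMeasure) :
    FieldL2 →L[ℂ] FieldL2 :=
  crossX.holderL cellMeasure ⊤ 2 2 hU.toLp

theorem coeFn_fieldOp (hU : MemLp (fun x => toC3 (U x)) ⊤ cellMeasure) (F : FieldL2) :
    fieldOp hU F =ᵐ[cellMeasure] fun x => crossX (toC3 (U x)) (F x) := by
  have h1 := crossX.coeFn_holder (r := 2) hU.toLp F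
  have h2 : (fieldOp hU F : E3 → X3) = (crossX.holder 2 hU.toLp F : FieldL2) := rfl
  rw [h2]
  filter_upwards [h1, hU.coeFn_toLp] with x hx hx2
  rw [hx, hx2]

/-- The operator `H ↦ U × H` on Fourier coefficients. -/
noncomputable def coefOp (hU : MemLp (fun x => toC3 (U x)) ⊤ cellMeasure) : Coef →L[ℂ] Coef :=
  (fourierIso.toContinuousLinearEquiv : FieldL2 →L[ℂ] Coef) ∘L fieldOp hU ∘L
    (fourierIso.symm.toContinuousLinearEquiv : Coef →L[ℂ] FieldL2)

theorem coefOp_fourierIso (hU : MemLp (fun x => toC3 (U x)) ⊤ cellMeasure) (F : FieldL2) :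
    coefOp hU (fourierIso F) = fourierIso (fieldOp hU F) := by
  show fourierIso (fieldOp hU (fourierIso.symm (fourierIso F))) = _
  rw [fourierIso.symm_apply_apply]

/-- P²y is the curl of s = NPy, which turns the pairing in the energy estimate into ⟨U × s, ∇ × s⟩.
-/
theorem symbP_eq_curl (k : Freq) (y : X3) :
    symbP k (symbP k y) = Complex.I • crossX (toC3 (freqVec k)) (symbN k (symbP k y)) := by
  rw [symbP_apply k (symbP k y), symbN_apply, map_smul, smul_smul, mul_comm]

theorem freq_dot_symbP (k : Freq) (y : X3) : ∑ a, (k a : ℂ) * symbP k y a = 0 := by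
  rw [Fin.sum_univ_three, symbP_apply]
  simp only [PiLp.smul_apply, crossX_apply_zero, crossX_apply_one, crossX_apply_two, smul_eq_mul,
    toC3, freqVec_apply, Complex.ofReal_intCast]
  ring

/-- The energy estimate for `U ×` on Fourier coefficients. -/
theorem re_inner_coefOp_le (hper : IsPeriodic U) {K : NNReal} (hK : LipschitzWith K U)
    (hdiv : modalDiv 0 (distOfField fun x => toC3 (U x)) = 0) {c : ℝ}
    (hc : ∀ᵐ x ∂cellMeasure, ‖fderiv ℝ U x‖ ≤ c)
    (hU : MemLp (fun x => toC3 (U x)) ⊤ cellMeasure) (y : Coef) :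
    (⟪coefOp hU (opN (opP y)), opP (opP y)⟫_ℂ).re ≤ c * ‖opN (opP y)‖ ^ 2 := by
  -- Both sides are continuous in y, so finitely supported coefficients suffice; for these all
  -- fields are trigonometric polynomials and `integral_energyDensity_le` applies.
  have hclosed : IsClosed {y : Coef |
      (⟪coefOp hU (opN (opP y)), opP (opP y)⟫_ℂ).re ≤ c * ‖opN (opP y)‖ ^ 2} :=
    isClosed_le (by fun_prop) (by fun_prop)
  have hlim : Filter.Tendsto (fun A : Finset Freq => ∑ k ∈ A, lp.single 2 k (y k))
    Filter.atTop (𝓝 y) := lp.hasSum_single (by norm_num) y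
  refine hclosed.mem_of_tendsto hlim (Filter.Eventually.of_forall fun A => ?_)
  generalize hz : ∑ k ∈ A, lp.single (E := fun _ : Freq => X3) 2 k (y k) = z
  have hzA : ∀ k ∉ A, z k = 0 := by
    intro k hk
    rw [← hz, lp.coeFn_sum, Finset.sum_apply]
    refine Finset.sum_eq_zero fun l hl => lp.single_apply_ne _ _ _ ?_
    rintro rfl
    exact hk hl
  show (⟪coefOp hU (opN (opP z)), opP (opP z)⟫_ℂ).re ≤ c * ‖opN (opP z)‖ ^ 2
  have hs : ∀ k, opN (opP z) k = symbN k (symbP k (z k)) := fun k => rfl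
  have hw : ∀ k, opP (opP z) k = Complex.I • crossX (toC3 (freqVec k)) (opN (opP z) k) :=
    fun k => symbP_eq_curl k (z k)
  have hdivs : ∀ k, ∑ a, (k a : ℂ) * opN (opP z) k a = 0 := fun k => by
    have := freq_dot_symbP k (z k)
    simp only [hs, symbN_apply, PiLp.smul_apply, smul_eq_mul, mul_left_comm _ (Complex.ofReal _),
      ← Finset.mul_sum, this, mul_zero]
  have hsA : ∀ k ∉ A, opN (opP z) k = 0 := fun k hk => by rw [hs, hzA k hk, map_zero, map_zero]
  have hwA : ∀ k ∉ A, opP (opP z) k = 0 := fun k hk => by rw [hw, hsA k hk, map_zero, smul_zero]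
  generalize opN (opP z) = s at *
  generalize opP (opP z) = w at *
  set S : Fin 3 → TorusTest := fun a => TorusTest.trig A fun k => s k a with hS
  have hSdiv : ∀ x, ∑ a, ((S a).pderiv a).toFun x = 0 := fun x => by
    simp only [hS, TorusTest.trig_pderiv]
    rw [Finset.sum_comm]
    refine Finset.sum_eq_zero fun k _ => ?_
    have : ∀ a, s k a * (Complex.I * k a * expo k x) = Complex.I * expo k x * (k a * s k a) :=
      fun a => by ring
    simp only [this, ← Finset.mul_sum, hdivs k, mul_zero]
  have hcurl : ∀ x a, testCurl S x a = (TorusTest.trig A fun k => w k a).toFun x := by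
    intro x a
    fin_cases a <;>
      simp only [testCurl, hS, TorusTest.trig_pderiv, TorusTest.trig_apply, hw, PiLp.smul_apply,
        ← Finset.sum_sub_distrib, crossX_apply_zero, crossX_apply_one, crossX_apply_two, toC3,
        freqVec_apply, smul_eq_mul, Fin.zero_eta, Fin.mk_one, Fin.reduceFinMk,
        Matrix.cons_val_zero, Matrix.cons_val_one, Matrix.cons_val, Complex.ofReal_intCast] <;>
      exact Finset.sum_congr rfl fun k _ => by ring
  have htS := memLp_of_test S
  have htW := memLp_of_test fun a => TorusTest.trig A fun k => w k a
  have hFS : fourierIso htS.toLp = s := fourierIso_trig hsA htS fun x a => rfl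
  have hFW : fourierIso htW.toLp = w := fourierIso_trig hwA htW fun x a => rfl
  have hnorm : ‖s‖ ^ 2 = ∫ x, ∑ a, ‖(S a).toFun x‖ ^ 2 ∂cellMeasure := by
    have h1 : ((‖s‖ ^ 2 : ℝ) : ℂ) = ∫ x, ((∑ a, ‖(S a).toFun x‖ ^ 2 : ℝ) : ℂ) ∂cellMeasure := by
      rw [← hFS, LinearIsometryEquiv.norm_map, Complex.ofReal_pow]
      refine (inner_self_eq_norm_sq_to_K (𝕜 := ℂ) (htS.toLp)).symm.trans ?_
      rw [L2.inner_def]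
      refine integral_congr_ae ?_
      filter_upwards [htS.coeFn_toLp] with x hx
      rw [hx, inner_self_eq_norm_sq_to_K]
      have h2 := EuclideanSpace.norm_sq_eq (WithLp.toLp 2 fun a => (S a).toFun x : X3)
      simp only at h2
      rw [← h2, Complex.ofReal_pow]
      rfl
    rw [integral_complex_ofReal] at h1
    exact_mod_cast h1
  -- The inner product conjugates its first argument, hence the conjugate; the real part does not
  -- see it.
  have hae : (fun x => ⟪(fieldOp hU htS.toLp : E3 → X3) x, (htW.toLp : E3 → X3) x⟫_ℂ)
      =ᵐ[cellMeasure] fun x => conj (energyDensity U S x) := by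
    filter_upwards [htS.coeFn_toLp, htW.coeFn_toLp, coeFn_fieldOp hU htS.toLp] with x h1 h2 h3
    rw [h2, h3, h1, PiLp.inner_apply, energyDensity, map_sum]
    refine Finset.sum_congr rfl fun i _ => ?_
    rw [hcurl, RCLike.inner_apply, map_mul, Complex.conj_conj, mul_comm]
    rfl
  have hinner : ⟪coefOp hU s, w⟫_ℂ = ∫ x, conj (energyDensity U S x) ∂cellMeasure := by
    rw [← hFS, ← hFW, coefOp_fourierIso, LinearIsometryEquiv.inner_map_map, L2.inner_def]
    exact integral_congr_ae hae
  have hint := (L2.integrable_inner (𝕜 := ℂ) (fieldOp hU htS.toLp) htW.toLp).congr hae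
  have hre := integral_re hint
  simp only [RCLike.re_eq_complex_re, Complex.conj_re] at hre
  rw [hinner, hnorm, ← hre]
  exact integral_energyDensity_le hper hK hdiv hc S hSdiv

end Field

end
-- Distributions through their Fourier coefficients
section

open scoped InnerProductSpace ComplexConjugate Topology

section Distributions

/-- The pairing of `e^{i k · x}` with a test function. -/
noncomputable def testCoeff (k : Freq) (φ : TorusTest) : ℂ := ∫ x in cell, expo k x * φ.toFun x

/-- `c` is the family of Fourier coefficients of the distribution `T`. -/
def HasCoeff (T : TorusDist) (c : Freq → ℂ) : Prop :=
  ∀ φ, HasSum (fun k => testCoeff k φ * c k) (T φ)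

theorem testCoeff_pderiv (k : Freq) (a : Fin 3) (φ : TorusTest) :
    testCoeff k (φ.pderiv a) = -(Complex.I * k a) * testCoeff k φ := by
  obtain ⟨K, hK⟩ := (expoTest k).exists_lipschitz
  have h := integral_fderiv_mul (expoTest k).periodic hK φ a
  have h2 : ∫ x, fderiv ℝ (expoTest k).toFun x (EuclideanSpace.single a 1) * φ.toFun x
      ∂cellMeasure = Complex.I * k a * ∫ x, expo k x * φ.toFun x ∂cellMeasure := by
    rw [← integral_const_mul]
    refine integral_congr_ae (Filter.Eventually.of_forall fun x => ?_)
    show ((expoTest k).pderiv a).toFun x * _ = _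
    rw [expoTest_pderiv]
    ring
  rw [h2] at h
  rw [testCoeff, testCoeff, setIntegral_cell, setIntegral_cell, mul_smul_comm, neg_mul, h, neg_neg]
  rfl

theorem testCoeff_expoTest (k l : Freq) :
    testCoeff l (expoTest (-k)) = if l = k then (cellVolume : ℂ) else 0 := by
  have : ∀ x, expo l x * (expoTest (-k)).toFun x = expo (l - k) x := fun x => by
    rw [sub_eq_add_neg, ← expo_mul]; rfl
  simp only [testCoeff, setIntegral_cell, this, integral_expo, sub_eq_zero]
  split_ifs <;> simp

namespace HasCoeff

variable {T T' : TorusDist} {c c' : Freq → ℂ}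

theorem apply_expoTest (h : HasCoeff T c) (k : Freq) : T (expoTest (-k)) = cellVolume * c k := by
  have h1 := h (expoTest (-k))
  simp only [testCoeff_expoTest] at h1
  refine h1.unique ?_
  convert hasSum_ite_eq k (cellVolume * c k) using 2 with l
  split_ifs with hl
  · rw [hl]
  · rw [zero_mul]

/-- Testing against e^{-ik·x} isolates the k-th coefficient. -/
theorem coeff_unique (h : HasCoeff T c) (h' : HasCoeff T c') : c = c' := by
  funext k
  have := (h.apply_expoTest k).symm.trans (h'.apply_expoTest k)
  exact mul_left_cancel₀ (by exact_mod_cast cellVolume_pos.ne') this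

theorem unique (h : HasCoeff T c) (h' : HasCoeff T' c) : T = T' :=
  funext fun φ => (h φ).unique (h' φ)

theorem add (h : HasCoeff T c) (h' : HasCoeff T' c') :
    HasCoeff (T + T') fun k => c k + c' k := fun φ =>
  HasSum.congr_fun ((h φ).add (h' φ)) fun _ => mul_add _ _ _

theorem sub (h : HasCoeff T c) (h' : HasCoeff T' c') :
    HasCoeff (T - T') fun k => c k - c' k := fun φ =>
  HasSum.congr_fun ((h φ).sub (h' φ)) fun _ => mul_sub _ _ _

theorem smul (h : HasCoeff T c) (p : ℂ) : HasCoeff (p • T) fun k => p * c k := fun φ =>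
  HasSum.congr_fun ((h φ).mul_left p) fun _ => mul_left_comm _ _ _

theorem zero : HasCoeff 0 fun _ => 0 := fun _ =>
  HasSum.congr_fun hasSum_zero fun _ => mul_zero _

theorem sum {T : Fin 3 → TorusDist} {c : Fin 3 → Freq → ℂ} (h : ∀ a, HasCoeff (T a) (c a)) :
    HasCoeff (∑ a, T a) fun k => ∑ a, c a k := by
  simp only [Fin.sum_univ_three]
  exact ((h 0).add (h 1)).add (h 2)

theorem congr (h : HasCoeff T c) (hc : ∀ k, c k = c' k) : HasCoeff T c' := by
  rwa [← funext hc]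

theorem modalD (h : HasCoeff T c) (j : E3) (a : Fin 3) :
    HasCoeff (modalD j a T) fun k => Complex.I * toC3 (freqVec k + j) a * c k := fun φ => by
  have h1 := (h (φ.pderiv a)).neg.add ((h φ).mul_left (Complex.I * (j a : ℂ)))
  refine HasSum.congr_fun h1 fun k => ?_
  rw [testCoeff_pderiv]
  simp only [toC3, PiLp.add_apply, freqVec_apply]
  push_cast
  ring

end HasCoeff

/-- `c` is the family of Fourier coefficients of the vector-valued distribution `T`. -/
def HasCoeffs (T : Fin 3 → TorusDist) (c : Freq → X3) : Prop :=
  ∀ i, HasCoeff (T i) fun k => c k i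

namespace HasCoeffs

variable {T T' : Fin 3 → TorusDist} {c c' : Freq → X3}

theorem unique (h : HasCoeffs T c) (h' : HasCoeffs T' c) : T = T' :=
  funext fun i => (h i).unique (h' i)

theorem coeff_unique (h : HasCoeffs T c) (h' : HasCoeffs T c') : c = c' := by
  funext k
  ext i
  exact congrFun ((h i).coeff_unique (h' i)) k

theorem add (h : HasCoeffs T c) (h' : HasCoeffs T' c') : HasCoeffs (T + T') fun k => c k + c' k :=
  fun i => (h i).add (h' i)

theorem smul (h : HasCoeffs T c) (p : ℂ) : HasCoeffs (p • T) fun k => p • c k :=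
  fun i => (h i).smul p

theorem congr (h : HasCoeffs T c) (hc : ∀ k, c k = c' k) : HasCoeffs T c' := by
  rwa [← funext hc]

theorem modalCurl (h : HasCoeffs T c) (j : E3) :
    HasCoeffs (modalCurl j T) fun k => Complex.I • crossX (toC3 (freqVec k + j)) (c k) := by
  have hD : ∀ a i, _ := fun a i => (h i).modalD j a
  intro i
  fin_cases i
  · refine ((hD 1 2).sub (hD 2 1)).congr fun k => ?_
    simp only [Fin.zero_eta, PiLp.smul_apply, crossX_apply_zero, smul_eq_mul]
    ring
  · refine ((hD 2 0).sub (hD 0 2)).congr fun k => ?_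
    simp only [Fin.mk_one, PiLp.smul_apply, crossX_apply_one, smul_eq_mul]
    ring
  · refine ((hD 0 1).sub (hD 1 0)).congr fun k => ?_
    simp only [Fin.reduceFinMk, PiLp.smul_apply, crossX_apply_two, smul_eq_mul]
    ring

theorem modalLaplacian (h : HasCoeffs T c) (j : E3) :
    HasCoeffs (modalLaplacian j T) fun k => -(((‖freqVec k + j‖ ^ 2 : ℝ) : ℂ) • c k) := by
  intro i
  refine (HasCoeff.sum fun a => ((h i).modalD j a).modalD j a).congr fun k => ?_
  simp only [EuclideanSpace.norm_sq_eq, Fin.sum_univ_three, PiLp.neg_apply, PiLp.smul_apply,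
    smul_eq_mul, toC3, Real.norm_eq_abs, sq_abs]
  push_cast
  linear_combination (((freqVec k + j) 0 : ℂ) ^ 2 + ((freqVec k + j) 1 : ℂ) ^ 2 +
    ((freqVec k + j) 2 : ℂ) ^ 2) * c k i * Complex.I_sq

theorem modalDiv (h : HasCoeffs T c) (j : E3) : HasCoeff (modalDiv j T) fun k =>
    ∑ a, Complex.I * toC3 (freqVec k + j) a * c k a :=
  HasCoeff.sum fun a => (h a).modalD j a

end HasCoeffs

/-- The Fourier coefficients of a square-integrable field. -/
theorem hasCoeffs_distOfField {F : E3 → C3} {G : FieldL2}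
    (hFG : ∀ᵐ x ∂cellMeasure, (G x).ofLp = F x) :
    HasCoeffs (distOfField F) fun k => fourierIso G k := by
  intro i φ
  obtain ⟨D, hD⟩ := φ.exists_bound
  -- The pairing of the i-th component with φ is the inner product with φ̄ eᵢ, and its expansion in
  -- modes is Parseval's identity.
  have hg : MemLp (fun x => conj (φ.toFun x) • (EuclideanSpace.single i 1 : X3)) 2 cellMeasure :=
    MemLp.of_bound ((Complex.continuous_conj.comp φ.continuous).smul
      continuous_const).aestronglyMeasurable D (Filter.Eventually.of_forall fun x => by
        simpa [norm_smul] using hD x)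
  have h1 : ⟪hg.toLp, G⟫_ℂ = ∫ x, F x i * φ.toFun x ∂cellMeasure := by
    rw [L2.inner_def]
    refine integral_congr_ae ?_
    filter_upwards [hg.coeFn_toLp, hFG] with x hx hx2
    rw [hx, inner_smul_left, inner_single_one_left, Complex.conj_conj, ← hx2, mul_comm]
  have h2 : ∀ k, ⟪fourierIso hg.toLp k, fourierIso G k⟫_ℂ =
      (∫ x, expo k x * φ.toFun x ∂cellMeasure) * fourierIso G k i := by
    intro k
    rw [← inner_conj_symm, inner_fourierIso_apply, ← integral_conj, ← integral_mul_const]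
    refine integral_congr_ae ?_
    filter_upwards [hg.coeFn_toLp] with x hx
    rw [hx, inner_smul_right, map_mul, map_mul, Complex.conj_conj, Complex.conj_conj,
      inner_conj_symm, inner_single_one_left]
    ring
  have h3 := lp.hasSum_inner (𝕜 := ℂ) (fourierIso hg.toLp) (fourierIso G)
  rw [LinearIsometryEquiv.inner_map_map, h1] at h3
  simp only [h2] at h3
  have h4 := h3.const_smul cellVolume
  rw [distOfField, distOf, setIntegral_cell]
  refine HasSum.congr_fun h4 fun k => ?_
  rw [testCoeff, setIntegral_cell, smul_mul_assoc]

end Distributions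

section Fields

theorem MemL2.memLp {F : E3 → C3} (hF : MemL2 F) :
    MemLp (fun x => (WithLp.toLp 2 (F x) : X3)) 2 cellMeasure :=
  memLp_piLp_iff.2 fun a => memLp_pi_iff.1 (memLp_cell_iff.1 hF.2) a

/-- The class of a square-integrable field. -/
noncomputable def MemL2.toField {F : E3 → C3} (hF : MemL2 F) : FieldL2 := hF.memLp.toLp

theorem MemL2.toField_ae {F : E3 → C3} (hF : MemL2 F) :
    ∀ᵐ x ∂cellMeasure, (hF.toField x).ofLp = F x := by
  filter_upwards [hF.memLp.coeFn_toLp] with x hx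
  rw [toField, hx]

/-- The periodic function with given Fourier coefficients. -/
noncomputable def ofCoef (h : Coef) (x : E3) : C3 :=
  ((fourierIso.symm h : FieldL2) (cellLift (torusMk x))).ofLp

theorem ofCoef_ae (h : Coef) :
    ∀ᵐ x ∂cellMeasure, ((fourierIso.symm h : FieldL2) x).ofLp = ofCoef h x := by
  filter_upwards [ae_cell_iff.1 (ae_restrict_mem measurableSet_cell)] with x hx
  rw [ofCoef, cellLift_torusMk hx]

theorem memL2_ofCoef (h : Coef) : MemL2 (ofCoef h) := by
  refine ⟨isPeriodic_comp_torusMk fun t => ((fourierIso.symm h : FieldL2) (cellLift t)).ofLp, ?_⟩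
  rw [memLp_cell_iff]
  refine MemLp.ae_eq (ofCoef_ae h) (memLp_pi_iff.2 fun a => ?_)
  exact (Lp.memLp (fourierIso.symm h : FieldL2)).eval_piLp a

theorem hasCoeffs_ofCoef (h : Coef) : HasCoeffs (distOfField (ofCoef h)) fun k => h k := by
  simpa only [LinearIsometryEquiv.apply_symm_apply] using hasCoeffs_distOfField (ofCoef_ae h)

variable {U : E3 → E3} (hU : MemLp (fun x => toC3 (U x)) ⊤ cellMeasure)

theorem fieldOp_ae {F : E3 → C3} {G : FieldL2} (hFG : ∀ᵐ x ∂cellMeasure, (G x).ofLp = F x) :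
    ∀ᵐ x ∂cellMeasure, (fieldOp hU G x).ofLp = crossField U F x := by
  filter_upwards [hFG, coeFn_fieldOp hU G] with x h1 h2
  rw [h2, ofLp_crossX, h1]
  rfl

theorem hasCoeffs_crossField {F : E3 → C3} {G : FieldL2}
    (hFG : ∀ᵐ x ∂cellMeasure, (G x).ofLp = F x) :
    HasCoeffs (distOfField (crossField U F)) fun k => coefOp hU (fourierIso G) k := by
  rw [coefOp_fourierIso]
  exact hasCoeffs_distOfField (fieldOp_ae hU hFG)

theorem fourierIso_const (v : C3) {hv : MemLp (fun _ : E3 => (WithLp.toLp 2 v : X3)) 2 cellMeasure} :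
    fourierIso hv.toLp = constCoef (WithLp.toLp 2 v) := by
  ext1
  funext k
  ext a
  rw [fourierIso_toLp_apply, integral_mul_const, integral_expo]
  rcases eq_or_ne k 0 with rfl | hk
  · rw [constCoef_apply_zero]; simp
  · rw [constCoef_apply_ne _ hk, if_neg (neg_ne_zero.2 hk), zero_mul]; rfl

theorem coefOp_const_ae (v : C3) : ∀ᵐ x ∂cellMeasure,
    (fieldOp hU (memLp_const (WithLp.toLp 2 v : X3)).toLp x).ofLp = crossProduct (toC3 (U x)) v := by
  refine fieldOp_ae hU (F := fun _ => v) ?_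
  filter_upwards [(memLp_const (WithLp.toLp 2 v : X3)).coeFn_toLp] with x hx
  rw [hx]

theorem fourierIso_zero_apply (G : FieldL2) (a : Fin 3) :
    fourierIso G 0 a = ∫ x, G x a ∂cellMeasure := by
  rw [fourierIso_apply]
  simp only [neg_zero, expo_zero, one_mul]

theorem integrable_eval (G : FieldL2) (a : Fin 3) : Integrable (fun x => G x a) cellMeasure :=
  ((Lp.memLp G).eval_piLp a).integrable (by norm_num)

/-- The mean of a field is its zeroth Fourier coefficient. -/
theorem integral_eq_fourierIso_zero {F : E3 → C3} {G : FieldL2}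
    (hFG : ∀ᵐ x ∂cellMeasure, (G x).ofLp = F x) :
    ∫ x, F x ∂cellMeasure = (fourierIso G 0).ofLp := by
  funext a
  rw [eval_integral]
  · rw [fourierIso_zero_apply]
    refine integral_congr_ae ?_
    filter_upwards [hFG] with x hx
    rw [← hx]
  · intro b
    refine (integrable_eval G b).congr ?_
    filter_upwards [hFG] with x hx
    rw [← hx]

/-- The mean commutes with w ↦ w × v, and U is mean-free. -/
theorem coefOp_const_zero (hint : Integrable U cellMeasure) (hmean : ∫ x, U x ∂cellMeasure = 0)
    (v : X3) : coefOp hU (constCoef v) 0 = 0 := by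
  have hi : Integrable (fun x => toC3 (U x)) cellMeasure := hU.integrable le_top
  have h0 : ∫ x, toC3 (U x) ∂cellMeasure = 0 := by
    funext a
    rw [eval_integral fun b => memLp_one_iff_integrable.1
      (memLp_pi_iff.1 (memLp_one_iff_integrable.2 hi) b)]
    simp only [toC3]
    rw [integral_complex_ofReal]
    have h : ∫ x, U x a ∂cellMeasure = 0 := by
      have := (EuclideanSpace.proj a : E3 →L[ℝ] ℝ).integral_comp_comm hint
      rwa [hmean, map_zero] at this
    rw [h, Complex.ofReal_zero, Pi.zero_apply]
  have h1 : fourierIso (memLp_const (μ := cellMeasure) v).toLp = constCoef v :=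
    fourierIso_const v.ofLp
  have h2 := integral_eq_fourierIso_zero (coefOp_const_ae hU v.ofLp)
  have h3 := (LinearMap.toContinuousLinearMap (crossProduct.flip v.ofLp)).integral_comp_comm hi
  rw [h0, map_zero] at h3
  rw [← h1, coefOp_fourierIso]
  exact WithLp.ofLp_injective 2 (h2.symm.trans h3)

end Fields

end
-- The cell problem, the alpha matrix and the modal equation
section

open scoped InnerProductSpace ComplexConjugate Topology

section Cell

variable {U : E3 → E3} (hU : MemLp (fun x => toC3 (U x)) ⊤ cellMeasure)

theorem symbN_symbP_apply (k : Freq) (b : X3) : symbN k (symbP k b) =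
    ((‖freqVec k‖⁻¹ : ℝ) : ℂ) ^ 2 • Complex.I • crossX (toC3 (freqVec k)) b := by
  rw [symbP_apply, symbN_apply, smul_smul, smul_smul]
  congr 1
  ring

/-- The cell problem, frequency by frequency. -/
theorem cell_coef_iff {k : Freq} (hk : k ≠ 0) (b b' s : X3) :
    Complex.I • crossX (toC3 (freqVec k + 0)) b + -(((‖freqVec k + 0‖ ^ 2 : ℝ) : ℂ) • s) =
      Complex.I • crossX (toC3 (freqVec k + 0)) (-b') ↔ s = symbN k (symbP k (b' + b)) := by
  have hne : ((‖freqVec k‖ : ℝ) : ℂ) ≠ 0 := by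
    have := one_le_norm_freqVec hk
    exact_mod_cast (by linarith : (0 : ℝ) < ‖freqVec k‖).ne'
  rw [symbN_symbP_apply, add_zero, map_neg, map_add, smul_neg, smul_add, Complex.ofReal_inv,
    inv_pow, eq_inv_smul_iff₀ (pow_ne_zero 2 hne), Complex.ofReal_pow]
  constructor
  · intro h
    have := eq_sub_of_add_eq h
    rw [this]
    abel
  · intro h
    rw [h]
    abel

theorem hasCoeffs_cell_left {S : E3 → C3} {G : FieldL2}
    (hSG : ∀ᵐ x ∂cellMeasure, (G x).ofLp = S x) :
    HasCoeffs (modalCurl 0 (distOfField (crossField U S)) + modalLaplacian 0 (distOfField S))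
      fun k => Complex.I • crossX (toC3 (freqVec k + 0)) (coefOp hU (fourierIso G) k) +
        -(((‖freqVec k + 0‖ ^ 2 : ℝ) : ℂ) • fourierIso G k) :=
  ((hasCoeffs_crossField hU hSG).modalCurl 0).add ((hasCoeffs_distOfField hSG).modalLaplacian 0)

/-- Since v × U = -U × v, the source is minus B applied to a constant, so it combines with U × S
into B(v + S). -/
theorem hasCoeffs_cell_right (v : C3) :
    HasCoeffs (modalCurl 0 (distOfField (fun x => crossProduct v (toC3 (U x)))))
      fun k => Complex.I • crossX (toC3 (freqVec k + 0))
        (-(coefOp hU (constCoef (WithLp.toLp 2 v)) k)) := by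
  have h1 : ∀ᵐ x ∂cellMeasure,
      ((-fieldOp hU (memLp_const (WithLp.toLp 2 v : X3)).toLp : FieldL2) x).ofLp =
        crossProduct v (toC3 (U x)) := by
    filter_upwards [coefOp_const_ae hU v, Lp.coeFn_neg
      (fieldOp hU (memLp_const (WithLp.toLp 2 v : X3)).toLp)] with x h1 h2
    rw [h2, Pi.neg_apply, WithLp.ofLp_neg, h1, cross_anticomm]
  have h2 := (hasCoeffs_distOfField h1).modalCurl 0
  refine h2.congr fun k => ?_
  rw [map_neg, ← coefOp_fourierIso, fourierIso_const]
  rfl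

/-- Nonzero modes are solved for by dividing by |k|². The equation says nothing at k = 0, where the
mean condition on S matches the vanishing of N. -/
theorem IsCellSolution.coef_eq {v : C3} {S : E3 → C3} (h : IsCellSolution U v S) :
    fourierIso h.1.toField =
      opN (opP (coefOp hU (constCoef (WithLp.toLp 2 v) + fourierIso h.1.toField))) := by
  obtain ⟨hS, heq, hmean⟩ := h
  have h1 := (hasCoeffs_cell_left hU hS.toField_ae).coeff_unique
    (heq ▸ hasCoeffs_cell_right hU v)
  ext1
  funext k
  rcases eq_or_ne k 0 with rfl | hk
  · have h0 : (fourierIso hS.toField 0).ofLp = 0 := by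
      rw [← integral_eq_fourierIso_zero hS.toField_ae]
      rw [setIntegral_cell] at hmean
      exact (smul_eq_zero.1 hmean).resolve_left cellVolume_pos.ne'
    have h2 : ∀ f : Coef, opN f 0 = 0 := fun f => by
      show symbN 0 (f 0) = 0
      simp [symbN_apply]
    rw [h2]
    exact WithLp.ofLp_injective 2 h0
  · rw [map_add]
    exact (cell_coef_iff hk _ _ _).1 (congrFun h1 k)

theorem isCellSolution_ofCoef {v : C3} {s : Coef}
    (h : s = opN (opP (coefOp hU (constCoef (WithLp.toLp 2 v) + s)))) :
    IsCellSolution U v (ofCoef s) := by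
  refine ⟨memL2_ofCoef s, ?_, ?_⟩
  · refine (hasCoeffs_cell_left hU (ofCoef_ae s)).unique
      ((hasCoeffs_cell_right hU v).congr fun k => ?_)
    rw [LinearIsometryEquiv.apply_symm_apply]
    rcases eq_or_ne k 0 with rfl | hk
    · have : toC3 0 = 0 := by ext i; simp [toC3]
      simp [this]
    · refine ((cell_coef_iff hk _ _ _).2 ?_).symm
      have := congrArg (fun f : Coef => f k) h
      rw [map_add] at this
      exact this
  · rw [setIntegral_cell, integral_eq_fourierIso_zero (ofCoef_ae s),
      LinearIsometryEquiv.apply_symm_apply]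
    have h0 : s 0 = 0 := by
      rw [h]
      show symbN 0 _ = 0
      simp [symbN_apply]
    rw [h0]
    simp

theorem cell_coef_unique (hunit : IsUnit (1 - opN * opP * coefOp hU)) {v : X3} {s s' : Coef}
    (h : s = opN (opP (coefOp hU (constCoef v + s))))
    (h' : s' = opN (opP (coefOp hU (constCoef v + s')))) : s = s' := by
  obtain ⟨u, hu⟩ := hunit
  have h1 : (1 - opN * opP * coefOp hU) s = (1 - opN * opP * coefOp hU) s' := by
    have e : ∀ t, (1 - opN * opP * coefOp hU) t = t - opN (opP (coefOp hU t)) := fun t => rfl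
    simp only [map_add] at h h'
    rw [e, e, sub_eq_of_eq_add h, sub_eq_of_eq_add h']
  rw [← hu] at h1
  have h2 := congrArg (↑u⁻¹ : Coef →L[ℂ] Coef) h1
  have e : ∀ t, (↑u⁻¹ : Coef →L[ℂ] Coef) ((u : Coef →L[ℂ] Coef) t) = t := fun t =>
    congrArg (fun L : Coef →L[ℂ] Coef => L t) u.inv_mul
  rwa [e, e] at h2

/-- The matrix `A(U, j)` in terms of Fourier coefficients. -/
theorem alphaMatrix_mulVec_single (hunit : IsUnit (1 - opN * opP * coefOp hU)) (j : E3)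
    (i : Fin 3) {s : Coef}
    (hs : s = opN (opP (coefOp hU (constCoef (EuclideanSpace.single i 1) + s)))) :
    (alphaMatrix U j).mulVec (Pi.single i 1) =
      (Complex.I • crossX (toC3 (‖j‖⁻¹ • j)) (coefOp hU s 0)).ofLp := by
  -- The arbitrary choice is harmless: `s` provides a solution, and invertibility forces the chosen
  -- one to have the same coefficients.
  have hsol : IsCellSolution U (Pi.single i 1) (solutionMap U (Pi.single i 1)) :=
    Classical.epsilon_spec (p := IsCellSolution U (Pi.single i 1))
      ⟨_, isCellSolution_ofCoef hU hs⟩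
  have h1 : fourierIso hsol.1.toField = s := cell_coef_unique hU hunit (hsol.coef_eq hU) hs
  have h2 : (alphaMatrix U j).mulVec (Pi.single i 1) = alphaMap U j (Pi.single i 1) := by
    rw [Matrix.mulVec_single_one]
    rfl
  rw [h2, alphaMap, average_cell, integral_eq_fourierIso_zero (fieldOp_ae hU hsol.1.toField_ae),
    ← coefOp_fourierIso, h1]
  rfl

end Cell

theorem AlphaUnstable.ae_norm_fderiv_le {U : E3 → E3} (hU : AlphaUnstable U) :
    ∃ c : ℝ, 0 ≤ c ∧ c < 1 ∧ ∀ᵐ x ∂cellMeasure, ‖fderiv ℝ U x‖ ≤ c := by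
  have h := hU.grad_lt_one
  have hne : eLpNorm (fderiv ℝ U) ⊤ volume ≠ ⊤ := h.ne_top
  refine ⟨(eLpNorm (fderiv ℝ U) ⊤ volume).toReal, ENNReal.toReal_nonneg, ?_, ?_⟩
  · rw [← ENNReal.toReal_one]
    exact (ENNReal.toReal_lt_toReal hne ENNReal.one_ne_top).2 h
  · refine ae_cell_iff.1 (ae_restrict_of_ae ?_)
    have h2 : ∀ᵐ x, ‖fderiv ℝ U x‖ₑ ≤ eLpNorm (fderiv ℝ U) ⊤ volume := by
      rw [eLpNorm_exponent_top]
      exact ae_le_eLpNormEssSup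
    filter_upwards [h2] with x hx
    rw [← toReal_enorm]
    exact ENNReal.toReal_mono hne hx

/-- A field with given Fourier coefficients solves the modal eigenvalue problem. -/
theorem modal_eigenfunction {U : E3 → E3} (hU : MemLp (fun x => toC3 (U x)) ⊤ cellMeasure)
    {j : E3} {p : ℂ} (hp : 0 < p.re) {h : Coef}
    (heq : ∀ k, Complex.I • crossX (toC3 (freqVec k + j)) (coefOp hU h k)
        - ((‖freqVec k + j‖ ^ 2 : ℝ) : ℂ) • h k = p • h k) :
    modalCurl j (distOfField (crossField U (ofCoef h))) + modalLaplacian j (distOfField (ofCoef h))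
        = p • distOfField (ofCoef h) ∧ modalDiv j (distOfField (ofCoef h)) = 0 := by
  have hc := hasCoeffs_crossField hU (ofCoef_ae h)
  rw [LinearIsometryEquiv.apply_symm_apply] at hc
  have hd := hasCoeffs_ofCoef h
  constructor
  · refine ((hc.modalCurl j).add (hd.modalLaplacian j)).unique ((hd.smul p).congr fun k => ?_)
    rw [← heq k, sub_eq_add_neg]
  · refine ((hd.modalDiv j).congr fun k => ?_).unique HasCoeff.zero
    have hk := heq k
    rw [sub_eq_iff_eq_add, ← add_smul] at hk
    -- Its real part is positive. As (k + j) · ((k + j) × b) = 0, the equation gives (p + |k +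
    -- j|²)(k + j) · Hₖ = 0.
    have hne : p + ((‖freqVec k + j‖ ^ 2 : ℝ) : ℂ) ≠ 0 := fun h0 => by
      have := congrArg Complex.re h0
      rw [Complex.add_re, Complex.ofReal_re, Complex.zero_re] at this
      nlinarith [sq_nonneg ‖freqVec k + j‖]
    refine (mul_eq_zero.1 ?_).resolve_left hne
    rw [Finset.mul_sum]
    have h1 : ∀ a, (p + ((‖freqVec k + j‖ ^ 2 : ℝ) : ℂ)) * h k a =
        Complex.I * crossX (toC3 (freqVec k + j)) (coefOp hU h k) a := fun a =>
      (congrArg (fun y : X3 => y a) hk).symm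
    simp only [mul_left_comm _ (Complex.I * _), h1, Fin.sum_univ_three, crossX_apply_zero,
      crossX_apply_one, crossX_apply_two]
    ring

theorem ofCoef_ne_zero {h : Coef} (hh : h ≠ 0) : ¬ ofCoef h =ᵐ[volume.restrict cell] 0 := by
  intro h0
  refine hh ?_
  rw [← fourierIso.symm.map_eq_zero_iff, Lp.eq_zero_iff_ae_eq_zero]
  filter_upwards [ofCoef_ae h, ae_cell_iff.1 h0] with x h1 h2
  exact WithLp.ofLp_injective 2 (h1.trans h2)

end
end AlphaEffect

/-! ### Conclusion -/

theorem mainTheorem3 (U : AlphaEffect.E3 → AlphaEffect.E3)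
    (hW : AlphaEffect.IsW1Infty U) (hU : AlphaEffect.AlphaUnstable U) :
    ∃ j : AlphaEffect.E3, ‖j‖ ≤ 1 ∧
      ∃ p : ℂ, 0 < p.re ∧
        ∃ H : AlphaEffect.E3 → AlphaEffect.C3,
          AlphaEffect.MemL2 H ∧
          ¬ H =ᵐ[volume.restrict AlphaEffect.cell] 0 ∧
          AlphaEffect.modalCurl j (AlphaEffect.distOfField (AlphaEffect.crossField U H))
              + AlphaEffect.modalLaplacian j (AlphaEffect.distOfField H)
            = p • AlphaEffect.distOfField H ∧
          AlphaEffect.modalDiv j (AlphaEffect.distOfField H) = 0 := by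
  obtain ⟨hper, K, hK⟩ := hW
  obtain ⟨c, hc0, hc1, hc⟩ := hU.ae_norm_fderiv_le
  obtain ⟨j, hj, μ, hμ, hre⟩ := hU.exists_unstable
  have hb := AlphaEffect.memLp_top_toC3 hper hK
  have hunit := AlphaEffect.isUnit_one_sub_opN_opP (AlphaEffect.coefOp hb) hc0 hc1
    (AlphaEffect.re_inner_coefOp_le hper hK hU.incompressible hc hb)
  have hint : Integrable U AlphaEffect.cellMeasure := by
    obtain ⟨C, hC⟩ := hper.exists_bound hK.continuous
    exact Integrable.of_bound hK.continuous.aestronglyMeasurable C (Filter.Eventually.of_forall hC)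
  have hmean : ∫ x, U x ∂AlphaEffect.cellMeasure = 0 := by
    have := hU.mean_free
    rw [AlphaEffect.setIntegral_cell] at this
    exact (smul_eq_zero.1 this).resolve_left AlphaEffect.cellVolume_pos.ne'
  -- The matrix A depends only on the direction of j, so the perturbation argument runs along the
  -- unit vector j/|j| and yields the wave vector εj/|j|.
  have hj1 : ‖‖j‖⁻¹ • j‖ = 1 := norm_smul_inv_norm hj
  obtain ⟨ε, hε0, hε1, p, hp, h, hh, heq⟩ := AlphaEffect.exists_unstable_coef hunit
    (AlphaEffect.coefOp_const_zero hb hint hmean) hj1 (AlphaEffect.alphaMatrix U j)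
    (fun i s hs => AlphaEffect.alphaMatrix_mulVec_single hb hunit j i hs) hμ hre
  refine ⟨ε • ‖j‖⁻¹ • j, ?_, p, hp, AlphaEffect.ofCoef h, AlphaEffect.memL2_ofCoef h,
    AlphaEffect.ofCoef_ne_zero hh, AlphaEffect.modal_eigenfunction hb hp heq⟩
  rw [norm_smul, hj1, mul_one, Real.norm_of_nonneg hε0.le]
  exact hε1
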